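/- **Setting.** Let $\mathcal S,\mathcal A$ be measurable spaces, $p(\cdot\mid s,a)$ a Markov transition kernel, and $\mathcal H_S,\mathcal H_A$ reproducing kernel Hilbert spaces of real functions on $\mathcal S$ and $\mathcal A$ with kernels $K_S,K_A$. Let $\phi=(\phi_1,\dots,\phi_{d_S})$ and $\psi=(\psi_1,\dots,\psi_{d_A})$ be measurable functions in $\mathcal H_S$ and $\mathcal H_A$ with $K_S(s,s')=\phi(s)^\top\phi(s')$ and $K_A(a,a')=\psi(a)^\top\psi(a')$, and let $K_{\max}=\max\{\sup_sK_S(s,s),\sup_aK_A(a,a)\}<\infty$. Assume that the transition operator $(\mathbb Pf)(s,a)=\int f(s')\,p(ds'\mid s,a)$ has Tucker rank at most $(r,l,m)$: there are $c_{ijk}\in\mathbb R$, $u_i,w_k\in\mathcal H_S$, $v_j\in\mathcal H_A$ with $$(\mathbb Pf)(s,a)=\sum_{i=1}^r\sum_{j=1}^l\sum_{k=1}^m c_{ijk}\,u_i(s)\,v_j(a)\,\langle f,w_k\rangle_{\mathcal H_S}\qquad\text{for all } f\in\mathcal H_S,\ s\in\mathcal S,\ a\in\mathcal A.$$ For a policy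 $\pi$ (a Markov kernel from $\mathcal S$ to $\mathcal A$) let $p^{t,\pi}$ be the $t$-step kernel of the induced Markov chain on $\mathcal S$ and $\nu^\pi$ its invariant distribution, and assume that the worst-case mixing time $$t_{mix}=\max_\pi\min\{t\ge1:\ \|p^{t',\pi}(\cdot\mid s_0)-\nu^\pi\|_{TV}\le\tfrac14\ \ \forall s_0\in\mathcal S,\ t'\ge t\}$$ is finite. Let $\bar\pi$ be a behavior policy with density $\bar\pi(a\mid s)$, and $\eta$ a probability measure with positive density $\eta(a)$, both with respect to a common $\sigma$-finite measure on $\mathcal A$. Let $\xi$ be the stationary state distribution under $\bar\pi$, and let $$\kappa=\sup_{s,a}\frac{\eta(a)}{\bar\pi(a\mid s)}<\infty,\qquad \bar\lambda=\sup_{\|u\|=\|v\|=\|w\|=1}\mathbb E\big[(u^\top\phi(S))^2(v^\top\psi(A))^2(w^\top\phi(S'))^2\big]>0,\qquad \boldsymbol F=\mathbb E[\phi(S)\circ\psi(A)\circ\phi(S')],$$ where $S\sim\xi$ and $A\sim\eta$ are independent and $S'\sim p(\cdot\mid S,A)$. The data are $n$ consecutive transitions $(s_i,a_i,s_i')$,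 $s_i'=s_{i+1}$, of a single sample path generated by $\bar\pi$ from an arbitrary initial state distribution. Let $$\bar{\boldsymbol F}=\frac1n\sum_{i=1}^n\frac{\eta(a_i)}{\bar\pi(a_i\mid s_i)}\,\phi(s_i)\circ\psi(a_i)\circ\phi(s_i'),$$ and let $\hat{\boldsymbol F}$ be any minimizer of $\|\boldsymbol Q-\bar{\boldsymbol F}\|_\sigma$ over tensors $\boldsymbol Q\in\mathbb R^{d_S\times d_A\times d_S}$ of Tucker rank (the triple of ranks of the matricizations) at most $(r,l,m)$. Here $\|\boldsymbol X\|_\sigma=\sup_{\|u\|=\|v\|=\|w\|=1}\langle\boldsymbol X,u\circ v\circ w\rangle$. **Lemma (concentration in tensor spectral norm).** Let $0<\delta<1$ and $n\ge2t_{mix}$. If $$\frac{n/t_{mix}}{(\log(n/t_{mix}))^2}\ \ge\ 1024\,\frac{\kappa K_{\max}^3}{\bar\lambda}\Big(\log\frac{t_{mix}}\delta+8(d_S+d_A)\Big),$$ then with probability at least $1-\delta$, $$\|\hat{\boldsymbol F}-\boldsymbol F\|_\sigma\ \le\ 64\sqrt{\frac{\kappa\bar\lambda\big(\log\frac{t_{mix}}\delta+8(d_S+d_A)\big)\big(\log\frac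 n{t_{mix}}\big)^2}{n/t_{mix}}}.$$ -/

import Mathlib

open MeasureTheory ProbabilityTheory
open scoped NNReal ENNReal

noncomputable section

namespace TensorMDP

/-! ### Order-3 tensors -/

/-- Real tensors of size `p × q × r`. -/
abbrev Tensor3 (p q r : ℕ) : Type := Fin p → Fin q → Fin r → ℝ

/-- The unit sphere of Euclidean space. -/
abbrev USphere (d : ℕ) : Type := Metric.sphere (0 : EuclideanSpace ℝ (Fin d)) 1

/-- The inner product `⟨X, u ∘ v ∘ w⟩` of a tensor with a rank-one tensor. -/
def Tensor3.apply {p q r : ℕ} (X : Tensor3 p q r) (u : EuclideanSpace ℝ (Fin p))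
    (v : EuclideanSpace ℝ (Fin q)) (w : EuclideanSpace ℝ (Fin r)) : ℝ :=
  ∑ i, ∑ j, ∑ k, X i j k * (u i * v j * w k)

/-- The tensor spectral norm: the supremum of `⟨X, u ∘ v ∘ w⟩` over unit vectors `u, v, w`. -/
def Tensor3.spectralNorm {p q r : ℕ} (X : Tensor3 p q r) : ℝ :=
  ⨆ x : USphere p × USphere q × USphere r,
    X.apply (x.1 : EuclideanSpace ℝ (Fin p)) (x.2.1 : EuclideanSpace ℝ (Fin q))
      (x.2.2 : EuclideanSpace ℝ (Fin r))

/-- Mode-1 matricization. -/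
def Tensor3.unfold1 {p q r : ℕ} (X : Tensor3 p q r) : Matrix (Fin p) (Fin q × Fin r) ℝ :=
  Matrix.of fun i jk => X i jk.1 jk.2

/-- Mode-2 matricization. -/
def Tensor3.unfold2 {p q r : ℕ} (X : Tensor3 p q r) : Matrix (Fin q) (Fin p × Fin r) ℝ :=
  Matrix.of fun j ik => X ik.1 j ik.2

/-- Mode-3 matricization. -/
def Tensor3.unfold3 {p q r : ℕ} (X : Tensor3 p q r) : Matrix (Fin r) (Fin p × Fin q) ℝ :=
  Matrix.of fun k ij => X ij.1 ij.2 k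

/-- The Tucker rank: the triple of the ranks of the three matricizations.  Triples are compared
coordinatewise (the product order on `ℕ × ℕ × ℕ`). -/
def Tensor3.tuckerRank {p q r : ℕ} (X : Tensor3 p q r) : ℕ × ℕ × ℕ :=
  (X.unfold1.rank, X.unfold2.rank, X.unfold3.rank)

/-- `Q` minimizes the spectral-norm distance to `X` among all tensors of Tucker rank at most
`R`. -/
def IsBestLowRankApprox {p q r : ℕ} (R : ℕ × ℕ × ℕ) (X Q : Tensor3 p q r) : Prop :=
  Q.tuckerRank ≤ R ∧
    ∀ Q' : Tensor3 p q r, Q'.tuckerRank ≤ R →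
      Tensor3.spectralNorm (Q - X) ≤ Tensor3.spectralNorm (Q' - X)

/-! ### Controlled Markov chains and the mixing time -/

section Chain

variable {S A : Type*} [MeasurableSpace S] [MeasurableSpace A]

/-- The one-step state kernel `p^π(· | s) = ∫ π(da | s) p(· | s, a)` of a policy `π`. -/
def policyKernel (p : Kernel (S × A) S) (π : Kernel S A) : Kernel S S :=
  (Kernel.compProd π p).snd

/-- The `t`-step state kernel `p^{t,π}`. -/
def stepKernel (p : Kernel (S × A) S) (π : Kernel S A) : ℕ → Kernel S S
  | 0 => Kernel.id
  | t + 1 => (policyKernel p π).comp (stepKernel p π t)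

/-- Total variation distance of two probability measures. -/
def tvDist (μ ν : Measure S) : ℝ :=
  ⨆ B : {B : Set S // MeasurableSet B}, |μ.real B.1 - ν.real B.1|

/-- The chain of the policy `π` has an invariant distribution `ν` such that at every time
`t' ≥ t`, from every starting state, the law of the state is within `1/4` of `ν`. -/
def IsMixedFrom (p : Kernel (S × A) S) (π : Kernel S A) (t : ℕ) : Prop :=
  ∃ ν : Measure S, IsProbabilityMeasure ν ∧ Kernel.Invariant (policyKernel p π) ν ∧
    ∀ t' : ℕ, t ≤ t' → ∀ s₀ : S, tvDist (stepKernel p π t' s₀) ν ≤ 1 / 4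

/-- The mixing time of one policy: the least step number `t ≥ 1` from which the chain is mixed
(`⊤` if there is none). -/
def policyMixingTime (p : Kernel (S × A) S) (π : Kernel S A) : ℕ∞ :=
  ⨅ t ∈ {t : ℕ | 1 ≤ t ∧ IsMixedFrom p π t}, (t : ℕ∞)

/-- The worst-case mixing time over all policies. -/
def worstMixingTime (p : Kernel (S × A) S) : ℕ∞ :=
  ⨆ π : {π : Kernel S A // IsMarkovKernel π}, policyMixingTime p π.1

/-- The state-action pairs at the first `i` steps. -/
def history {Ω : Type*} (s : ℕ → Ω → S) (a : ℕ → Ω → A) (i : ℕ) (ω : Ω) : Fin i → S × A :=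
  fun j => (s j ω, a j ω)

/-- `s 0, a 0, s 1, a 1, …, s n` is a sample path with `n` transitions of the decision process
with transition kernel `p` under the policy `π`, from an arbitrary initial state: given the past,
the action is drawn from `π(· | s i)` and the next state from `p(· | s i, a i)`. -/
structure IsSamplePath {Ω : Type*} [MeasurableSpace Ω] (P : Measure Ω) (p : Kernel (S × A) S)
    (π : Kernel S A) (n : ℕ) (s : ℕ → Ω → S) (a : ℕ → Ω → A) : Prop where
  measurable_state : ∀ i, Measurable (s i)
  measurable_action : ∀ i, Measurable (a i)
  action_law : ∀ i < n,
    P.map (fun ω => ((history s a i ω, s i ω), a i ω)) =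
      (P.map (fun ω => (history s a i ω, s i ω))).compProd (π.comap Prod.snd measurable_snd)
  state_law : ∀ i < n,
    P.map (fun ω => (history s a (i + 1) ω, s (i + 1) ω)) =
      (P.map (history s a (i + 1))).compProd
        (p.comap (fun h : Fin (i + 1) → S × A => h (Fin.last i))
          (measurable_pi_apply (Fin.last i)))

end Chain

/-! ### Reproducing kernel spaces, features and the low-rank assumption -/

section Features

variable {X : Type*} {H : Type*} [NormedAddCommGroup H] [InnerProductSpace ℝ H]
  [RKHS ℝ H X ℝ]

/-- The real-valued reproducing kernel `K(x, y)` of a space of real functions. -/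
def realKernel (H : Type*) [NormedAddCommGroup H] [InnerProductSpace ℝ H]
    [RKHS ℝ H X ℝ] [CompleteSpace H] (x y : X) : ℝ :=
  RKHS.kernel H x y 1

/-- Finitely many functions of the space which are features of its kernel:
`K(x, y) = ∑ i, φ i x * φ i y`. -/
def IsFeatureFamily [CompleteSpace H] {d : ℕ} (φ : Fin d → H) : Prop :=
  ∀ x y : X, realKernel H x y = ∑ i, φ i x * φ i y

/-- The feature vector `φ(x)`. -/
def featureVec {d : ℕ} (φ : Fin d → H) (x : X) : EuclideanSpace ℝ (Fin d) :=
  WithLp.toLp 2 fun i => φ i x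

end Features

section Model

variable {S A : Type*} [MeasurableSpace S] [MeasurableSpace A]
variable (HS HA : Type*) [NormedAddCommGroup HS] [InnerProductSpace ℝ HS] [RKHS ℝ HS S ℝ]
  [NormedAddCommGroup HA] [InnerProductSpace ℝ HA] [RKHS ℝ HA A ℝ]

/-- The transition operator `(ℙ f)(s, a) = ∫ f(s') p(ds' | s, a)` has Tucker rank at most
`(r, l, m)`: `(ℙ f)(s, a) = ∑ c_{ijk} u_i(s) v_j(a) ⟨f, w_k⟩` for all `f` in `HS`.  In particular
`ℙ f` is a finite sum of products of a function in `HS` and one in `HA`. -/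
def OperatorTuckerRankLE (p : Kernel (S × A) S) (r l m : ℕ) : Prop :=
  ∃ (c : Tensor3 r l m) (u : Fin r → HS) (v : Fin l → HA) (w : Fin m → HS),
    ∀ (f : HS) (s : S) (a : A),
      ∫ s', f s' ∂(p (s, a)) = ∑ i, ∑ j, ∑ k, c i j k * u i s * v j a * inner ℝ f (w k)

/-- `K_max = max (sup_s K_S(s, s)) (sup_a K_A(a, a))`. -/
def kernelMax [CompleteSpace HS] [CompleteSpace HA] : ℝ :=
  max (⨆ s : S, realKernel HS s s) (⨆ a : A, realKernel HA a a)

variable {HS HA} {dS dA : ℕ}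

/-- The law of `(S, A, S')` with `S ∼ ξ` and `A ∼ η` independent and `S' ∼ p(· | S, A)`. -/
def decoupledLaw (p : Kernel (S × A) S) (ξ : Measure S) (η : Measure A) :
    Measure ((S × A) × S) :=
  (ξ.prod η).compProd p

/-- The mean-embedding tensor `F = E[φ(S) ∘ ψ(A) ∘ φ(S')]` under the decoupled law. -/
def meanEmbedding (p : Kernel (S × A) S) (ξ : Measure S) (η : Measure A)
    (φ : Fin dS → HS) (ψ : Fin dA → HA) : Tensor3 dS dA dS :=
  fun i j k => ∫ x, φ i x.1.1 * ψ j x.1.2 * φ k x.2 ∂(decoupledLaw p ξ η)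

/-- `λ̄ = sup E[((u · φ(S)) (v · ψ(A)) (w · φ(S')))²]` over unit vectors `u, v, w`, under the
decoupled law. -/
def lambdaBar (p : Kernel (S × A) S) (ξ : Measure S) (η : Measure A)
    (φ : Fin dS → HS) (ψ : Fin dA → HA) : ℝ :=
  ⨆ y : USphere dS × USphere dA × USphere dS,
    ∫ x, (inner ℝ (y.1 : EuclideanSpace ℝ (Fin dS)) (featureVec φ x.1.1) *
      inner ℝ (y.2.1 : EuclideanSpace ℝ (Fin dA)) (featureVec ψ x.1.2) *
      inner ℝ (y.2.2 : EuclideanSpace ℝ (Fin dS)) (featureVec φ x.2)) ^ 2 ∂(decoupledLaw p ξ η)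

/-- `κ = sup_{s,a} η(a) / π(a | s)` for densities `e` of `η` and `b s` of `π(· | s)`; it is
infinite if `e a > 0 = b s a` somewhere. -/
def ratioSup (e : A → ℝ≥0) (b : S → A → ℝ≥0) : ℝ≥0∞ :=
  ⨆ (s : S) (a : A), (e a : ℝ≥0∞) / (b s a : ℝ≥0∞)

/-- The importance-sampling estimate
`F̄ = n⁻¹ ∑_{t<n} η(a_t)/π(a_t|s_t) · φ(s_t) ∘ ψ(a_t) ∘ φ(s_{t+1})` computed from a path. -/
def importanceEstimate (e : A → ℝ≥0) (b : S → A → ℝ≥0) (φ : Fin dS → HS) (ψ : Fin dA → HA)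
    (n : ℕ) (s : ℕ → S) (a : ℕ → A) : Tensor3 dS dA dS :=
  fun i j k => (n : ℝ)⁻¹ * ∑ t ∈ Finset.range n,
    ((e (a t) : ℝ) / (b (s t) (a t) : ℝ)) * (φ i (s t) * ψ j (a t) * φ k (s (t + 1)))

end Model

end TensorMDP

end

open TensorMDP

/-! Low rank enters only through a comparison. Applying the operator decomposition to the features
`φ k` and integrating against the product law `ξ.prod η` separates states from actions, so `F`
itself has Tucker rank at most `(r, l, m)` (`tuckerRank_meanEmbedding_le`). Hence `F` competes in
the minimization that defines `Fhat`, and the triangle inequality gives `‖Fhat - F‖ ≤ 2 ‖F̄ - F‖`.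
Replacing three unit vectors one after the other by points of nets of size `5 ^ d` keeps a factor
`(7/8)^3 > 1/2` of the value of a tensor, so what remains is a union bound over at most `5 ^ (2 dS +
dA)` scalar averages along the path.

For fixed `u, v, w` the averaged function is the importance weight times `(u · φ(s)) (v · ψ(a)) (w ·
φ(s'))`. The weight turns the stationary law of a transition into the decoupled law
(`withDensity_ratio_eq`), so the stationary mean is `⟨F, u ∘ v ∘ w⟩`. The function is bounded by `B
= κ K ^ (3/2)` and has second moment at most `V = κ λ̄`: of the two weights in the square, one
changes the law and the other is at most `κ`.

The dependence is handled by `IsSamplePath.bernstein`. Every `T = tmix` steps halve the distance of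
`P^t g` to the constants, uniformly in the starting state. So the moment generating function of an
observation, conditioned on the state `(k + 1) T` steps before, exceeds the stationary Bernstein
bound `1 + θ² V` by at most a multiple of `2 ^ -(k + 1) θ B`. Within a residue class modulo `(k + 1)
T + 1` these conditional bounds multiply; the classes are joined by convexity of `exp`, and only the
first factor of a class needs a crude bound, which is why any initial law is allowed. With `2 ^ k ≤
n / T < 2 ^ (k + 1)` the mixing error is of order `T / n`, and the spacing of the classes costs a
factor `log (n / T)`. The choice `θ = t / (2 V)` in Chernoff's bound then gives the tail `exp (-8
L)`, which absorbs the cardinality of the nets. -/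

namespace TensorMDP

/-! ### Nets of the sphere and the tensor spectral norm -/

/-- A half-net of the Euclidean unit sphere with at most `5 ^ d` points. -/
theorem exists_sphere_net (d : ℕ) : ∃ N : Finset (EuclideanSpace ℝ (Fin d)),
    N.card ≤ 5 ^ d ∧ (∀ u ∈ N, ‖u‖ = 1) ∧
      ∀ u : EuclideanSpace ℝ (Fin d), ‖u‖ = 1 → ∃ u' ∈ N, 7 / 8 ≤ inner ℝ u u' := by
  classical
  have hcard : ∀ N : Finset (EuclideanSpace ℝ (Fin d)), (∀ u ∈ N, ‖u‖ = 1) →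
      (∀ u ∈ N, ∀ v ∈ N, u ≠ v → 1 / 2 ≤ ‖u - v‖) → N.card ≤ 5 ^ d := by
    intro N h1 h2
    -- Doubling gives points of norm `2` with mutual distance at least `1`, the normalization of the
    -- packing bound `5 ^ d`.
    have hinj : Function.Injective fun u : EuclideanSpace ℝ (Fin d) => (2 : ℝ) • u :=
      smul_right_injective _ two_ne_zero
    have := Besicovitch.card_le_of_separated (N.image fun u => (2 : ℝ) • u) (by
      simp only [Finset.mem_image, forall_exists_index, and_imp]
      rintro _ u hu rfl
      simp [norm_smul, h1 u hu]) (by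
      simp only [Finset.mem_image, forall_exists_index, and_imp]
      rintro _ u hu rfl _ v hv rfl huv
      rw [← smul_sub, norm_smul]
      have := h2 u hu v hv (fun h => huv (by rw [h]))
      simp only [Real.norm_ofNat]
      linarith)
    simpa [Finset.card_image_of_injective _ hinj] using this
  -- Greedy construction: a unit vector with inner product below `7/8` to all chosen points has
  -- squared distance above `2 - 7/4 = 1/4` to each, so the separated set could be enlarged past `5
  -- ^ d`.
  by_contra! hcon
  have hex : ∀ k : ℕ, ∃ N : Finset (EuclideanSpace ℝ (Fin d)), N.card = k ∧
      (∀ u ∈ N, ‖u‖ = 1) ∧ (∀ u ∈ N, ∀ v ∈ N, u ≠ v → 1 / 2 ≤ ‖u - v‖) := by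
    intro k
    induction k with
    | zero => exact ⟨∅, by simp⟩
    | succ k ih =>
      obtain ⟨N, hk, h1, h2⟩ := ih
      obtain ⟨u, hu, hfar⟩ := hcon N (hcard N h1 h2) h1
      have hsep : ∀ v ∈ N, 1 / 2 ≤ ‖u - v‖ := by
        intro v hv
        have h3 := hfar v hv
        have h4 := norm_sub_sq_real u v
        rw [hu, h1 v hv] at h4
        nlinarith [norm_nonneg (u - v)]
      have huN : u ∉ N := by
        intro hmem
        have := hsep u hmem
        norm_num at this
      refine ⟨insert u N, by rw [Finset.card_insert_of_notMem huN, hk], ?_, ?_⟩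
      · intro v hv
        rcases Finset.mem_insert.1 hv with rfl | hv
        exacts [hu, h1 v hv]
      · intro v hv w hw hvw
        rcases Finset.mem_insert.1 hv with rfl | hvN <;>
          rcases Finset.mem_insert.1 hw with rfl | hwN
        · exact absurd rfl hvw
        · exact hsep w hwN
        · rw [norm_sub_rev]
          exact hsep v hvN
        · exact h2 v hvN w hwN hvw
  obtain ⟨N, hk, h1, h2⟩ := hex (5 ^ d + 1)
  have := hcard N h1 h2
  omega

variable {p q r : ℕ}

/-- A linear form takes at least `7 / 8` of its value at a unit vector somewhere on the net. -/
theorem exists_net_inner_ge {d : ℕ} {N : Finset (EuclideanSpace ℝ (Fin d))}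
    (hN : ∀ u : EuclideanSpace ℝ (Fin d), ‖u‖ = 1 → ∃ u' ∈ N, 7 / 8 ≤ inner ℝ u u')
    (h u : EuclideanSpace ℝ (Fin d)) (hu : ‖u‖ = 1) :
    ∃ u' ∈ N, 7 / 8 * inner ℝ h u ≤ inner ℝ h u' := by
  by_cases h0 : h = 0
  · obtain ⟨u', hu', -⟩ := hN u hu
    exact ⟨u', hu', by simp [h0]⟩
  have hpos : 0 < ‖h‖ := norm_pos_iff.2 h0
  -- The net point is taken near the direction of `h`, not near `u`: then `⟨h, u'⟩ ≥ 7/8 ‖h‖`, which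
  -- dominates the value at every unit vector.
  obtain ⟨u', hu', hle⟩ := hN (‖h‖⁻¹ • h) (by
    rw [norm_smul, norm_inv, norm_norm, inv_mul_cancel₀ hpos.ne'])
  refine ⟨u', hu', ?_⟩
  rw [real_inner_smul_left, ← div_eq_inv_mul, le_div_iff₀ hpos] at hle
  have := real_inner_le_norm h u
  rw [hu] at this
  linarith

theorem Tensor3.apply_eq_inner_left (X : Tensor3 p q r) (u : EuclideanSpace ℝ (Fin p))
    (v : EuclideanSpace ℝ (Fin q)) (w : EuclideanSpace ℝ (Fin r)) :
    X.apply u v w = inner ℝ (WithLp.toLp 2 fun i => ∑ j, ∑ k, X i j k * (v j * w k)) u := by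
  simp only [Tensor3.apply, PiLp.inner_apply, RCLike.inner_apply, conj_trivial, Finset.mul_sum]
  refine Finset.sum_congr rfl fun i _ => Finset.sum_congr rfl fun j _ =>
    Finset.sum_congr rfl fun k _ => by ring

theorem Tensor3.apply_eq_inner_mid (X : Tensor3 p q r) (u : EuclideanSpace ℝ (Fin p))
    (v : EuclideanSpace ℝ (Fin q)) (w : EuclideanSpace ℝ (Fin r)) :
    X.apply u v w = inner ℝ (WithLp.toLp 2 fun j => ∑ i, ∑ k, X i j k * (u i * w k)) v := by
  simp only [Tensor3.apply, PiLp.inner_apply, RCLike.inner_apply, conj_trivial, Finset.mul_sum]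
  rw [Finset.sum_comm]
  refine Finset.sum_congr rfl fun i _ => Finset.sum_congr rfl fun j _ =>
    Finset.sum_congr rfl fun k _ => by ring

theorem Tensor3.apply_eq_inner_right (X : Tensor3 p q r) (u : EuclideanSpace ℝ (Fin p))
    (v : EuclideanSpace ℝ (Fin q)) (w : EuclideanSpace ℝ (Fin r)) :
    X.apply u v w = inner ℝ (WithLp.toLp 2 fun k => ∑ i, ∑ j, X i j k * (u i * v j)) w := by
  simp only [Tensor3.apply, PiLp.inner_apply, RCLike.inner_apply, conj_trivial, Finset.mul_sum]
  simp_rw [Finset.sum_comm (γ := Fin r)]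
  refine Finset.sum_congr rfl fun i _ => Finset.sum_congr rfl fun j _ =>
    Finset.sum_congr rfl fun k _ => by ring

/-- With two arguments frozen the tensor is a linear form in the third, so each replacement costs a
factor `7/8`, and `(7/8)^3 = 343/512`. No approximation error of the form `u - u'` has to be
reabsorbed. -/
theorem Tensor3.exists_net_apply_ge (X : Tensor3 p q r)
    {N₁ : Finset (EuclideanSpace ℝ (Fin p))} {N₂ : Finset (EuclideanSpace ℝ (Fin q))}
    {N₃ : Finset (EuclideanSpace ℝ (Fin r))}
    (h₁ : ∀ u, ‖u‖ = 1 → ∃ u' ∈ N₁, 7 / 8 ≤ inner ℝ u u')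
    (h₂ : ∀ u, ‖u‖ = 1 → ∃ u' ∈ N₂, 7 / 8 ≤ inner ℝ u u')
    (h₃ : ∀ u, ‖u‖ = 1 → ∃ u' ∈ N₃, 7 / 8 ≤ inner ℝ u u')
    (u : EuclideanSpace ℝ (Fin p)) (v : EuclideanSpace ℝ (Fin q))
    (w : EuclideanSpace ℝ (Fin r)) (hu : ‖u‖ = 1) (hv : ‖v‖ = 1) (hw : ‖w‖ = 1) :
    ∃ u' ∈ N₁, ∃ v' ∈ N₂, ∃ w' ∈ N₃, 343 / 512 * X.apply u v w ≤ X.apply u' v' w' := by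
  obtain ⟨u', hu', h1⟩ := exists_net_inner_ge h₁
    (WithLp.toLp 2 fun i => ∑ j, ∑ k, X i j k * (v j * w k)) u hu
  rw [← X.apply_eq_inner_left, ← X.apply_eq_inner_left] at h1
  obtain ⟨v', hv', h2⟩ := exists_net_inner_ge h₂
    (WithLp.toLp 2 fun j => ∑ i, ∑ k, X i j k * (u' i * w k)) v hv
  rw [← X.apply_eq_inner_mid, ← X.apply_eq_inner_mid] at h2
  obtain ⟨w', hw', h3⟩ := exists_net_inner_ge h₃
    (WithLp.toLp 2 fun k => ∑ i, ∑ j, X i j k * (u' i * v' j)) w hw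
  rw [← X.apply_eq_inner_right, ← X.apply_eq_inner_right] at h3
  exact ⟨u', hu', v', hv', w', hw', by linarith⟩

/-- A real `⨆` over an unbounded family takes the default value `0`; boundedness makes the spectral
norm a true supremum. -/
theorem Tensor3.bddAbove_apply (X : Tensor3 p q r) :
    BddAbove (Set.range fun x : USphere p × USphere q × USphere r =>
      X.apply (x.1 : EuclideanSpace ℝ (Fin p)) (x.2.1 : EuclideanSpace ℝ (Fin q))
        (x.2.2 : EuclideanSpace ℝ (Fin r))) := by
  refine ⟨∑ i, ∑ j, ∑ k, |X i j k|, ?_⟩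
  rintro _ ⟨⟨⟨u, hu⟩, ⟨v, hv⟩, ⟨w, hw⟩⟩, rfl⟩
  refine Finset.sum_le_sum fun i _ => Finset.sum_le_sum fun j _ => Finset.sum_le_sum fun k _ => ?_
  have h1 : |u i| ≤ 1 := (PiLp.norm_apply_le u i).trans_eq (by simpa using hu)
  have h2 : |v j| ≤ 1 := (PiLp.norm_apply_le v j).trans_eq (by simpa using hv)
  have h3 : |w k| ≤ 1 := (PiLp.norm_apply_le w k).trans_eq (by simpa using hw)
  refine (le_abs_self _).trans ?_
  simp only [abs_mul]
  have h12 : |u i| * |v j| ≤ 1 := mul_le_one₀ h1 (abs_nonneg _) h2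
  exact mul_le_of_le_one_right (abs_nonneg _) (mul_le_one₀ h12 (abs_nonneg _) h3)

theorem Tensor3.apply_le_spectralNorm (X : Tensor3 p q r)
    (x : USphere p × USphere q × USphere r) :
    X.apply (x.1 : EuclideanSpace ℝ (Fin p)) (x.2.1 : EuclideanSpace ℝ (Fin q))
      (x.2.2 : EuclideanSpace ℝ (Fin r)) ≤ X.spectralNorm :=
  le_ciSup X.bddAbove_apply x

theorem Tensor3.apply_add (X Y : Tensor3 p q r) (u : EuclideanSpace ℝ (Fin p))
    (v : EuclideanSpace ℝ (Fin q)) (w : EuclideanSpace ℝ (Fin r)) :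
    (X + Y).apply u v w = X.apply u v w + Y.apply u v w := by
  simp [Tensor3.apply, add_mul, Finset.sum_add_distrib]

theorem Tensor3.apply_neg (X : Tensor3 p q r) (u : EuclideanSpace ℝ (Fin p))
    (v : EuclideanSpace ℝ (Fin q)) (w : EuclideanSpace ℝ (Fin r)) :
    (-X).apply u v w = -X.apply u v w := by
  simp [Tensor3.apply]

theorem Tensor3.apply_neg_left (X : Tensor3 p q r) (u : EuclideanSpace ℝ (Fin p))
    (v : EuclideanSpace ℝ (Fin q)) (w : EuclideanSpace ℝ (Fin r)) :
    X.apply (-u) v w = -X.apply u v w := by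
  simp [Tensor3.apply]

instance instNonemptyUSphere (d : ℕ) [NeZero d] : Nonempty (USphere d) := by
  have : Nontrivial (EuclideanSpace ℝ (Fin d)) := inferInstance
  exact (NormedSpace.sphere_nonempty.2 zero_le_one).to_subtype

variable [NeZero p] [NeZero q] [NeZero r]

theorem Tensor3.spectralNorm_add_le (X Y : Tensor3 p q r) :
    (X + Y).spectralNorm ≤ X.spectralNorm + Y.spectralNorm := by
  refine ciSup_le fun x => ?_
  rw [apply_add]
  exact add_le_add (X.apply_le_spectralNorm x) (Y.apply_le_spectralNorm x)

theorem Tensor3.spectralNorm_neg (X : Tensor3 p q r) : (-X).spectralNorm = X.spectralNorm := by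
  have key : ∀ X : Tensor3 p q r, (-X).spectralNorm ≤ X.spectralNorm := by
    intro X
    refine ciSup_le fun x => ?_
    rw [apply_neg, ← apply_neg_left]
    exact X.apply_le_spectralNorm (-x.1, x.2)
  exact le_antisymm (key X) (by simpa using key (-X))

/-- A tensor whose spectral norm exceeds `2 * t` exceeds `t` on the nets. -/
theorem Tensor3.exists_net_of_lt_spectralNorm (X : Tensor3 p q r)
    {N₁ : Finset (EuclideanSpace ℝ (Fin p))} {N₂ : Finset (EuclideanSpace ℝ (Fin q))}
    {N₃ : Finset (EuclideanSpace ℝ (Fin r))}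
    (h₁ : ∀ u, ‖u‖ = 1 → ∃ u' ∈ N₁, 7 / 8 ≤ inner ℝ u u')
    (h₂ : ∀ u, ‖u‖ = 1 → ∃ u' ∈ N₂, 7 / 8 ≤ inner ℝ u u')
    (h₃ : ∀ u, ‖u‖ = 1 → ∃ u' ∈ N₃, 7 / 8 ≤ inner ℝ u u')
    {t : ℝ} (ht : 0 ≤ t) (hX : 2 * t < X.spectralNorm) :
    ∃ u' ∈ N₁, ∃ v' ∈ N₂, ∃ w' ∈ N₃, t ≤ X.apply u' v' w' := by
  obtain ⟨⟨u, v, w⟩, hx⟩ := exists_lt_of_lt_ciSup hX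
  obtain ⟨u', hu', v', hv', w', hw', h⟩ := X.exists_net_apply_ge h₁ h₂ h₃ u v w
    (by simp) (by simp) (by simp)
  exact ⟨u', hu', v', hv', w', hw', by simp only at hx; linarith⟩

/-- `F` is admissible, so `Q` is at least as close to `X` as `F` is; the triangle inequality doubles
that distance. -/
theorem IsBestLowRankApprox.spectralNorm_sub_le {R : ℕ × ℕ × ℕ} {X Q F : Tensor3 p q r}
    (hQ : IsBestLowRankApprox R X Q) (hF : F.tuckerRank ≤ R) :
    (Q - F).spectralNorm ≤ 2 * (X - F).spectralNorm := by
  have h1 := hQ.2 F hF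
  have h2 := Tensor3.spectralNorm_add_le (Q - X) (X - F)
  have h3 := Tensor3.spectralNorm_neg (X - F)
  rw [neg_sub] at h3
  rw [sub_add_sub_cancel] at h2
  linarith

/-! ### Total variation and contraction towards the stationary law -/

section Mixing

variable {S A : Type*} [MeasurableSpace S] [MeasurableSpace A]

theorem abs_measureReal_sub_le_tvDist (μ ν : Measure S) [IsProbabilityMeasure μ]
    [IsProbabilityMeasure ν] {B : Set S} (hB : MeasurableSet B) :
    |μ.real B - ν.real B| ≤ tvDist μ ν := by
  refine le_ciSup (f := fun B : {B : Set S // MeasurableSet B} => |μ.real B.1 - ν.real B.1|)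
    ⟨1, ?_⟩ ⟨B, hB⟩
  rintro _ ⟨C, rfl⟩
  rw [abs_le]
  constructor <;> linarith [measureReal_nonneg (μ := μ) (s := C.1), measureReal_nonneg (μ := ν)
    (s := C.1), measureReal_le_one (μ := μ) (s := C.1), measureReal_le_one (μ := ν) (s := C.1)]

theorem integrable_of_abs_sub_le {μ : Measure S} [IsFiniteMeasure μ] {f : S → ℝ}
    (hf : Measurable f) {m R : ℝ} (hR : ∀ x, |f x - m| ≤ R) : Integrable f μ := by
  have h : Integrable (fun x => f x - m) μ :=
    Integrable.of_bound (hf.sub_const m).aestronglyMeasurable R (ae_of_all _ hR)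
  exact (h.add (integrable_const m)).congr (ae_of_all _ fun x => by simp)

/-- Layer-cake formula: after a shift the function takes values in `[0, 2R]`, and its integral is
the integral over that interval of the measures of superlevel sets, each of which changes by at most
the total variation distance. -/
theorem abs_integral_sub_integral_le_tvDist (μ ν : Measure S) [IsProbabilityMeasure μ]
    [IsProbabilityMeasure ν] {f : S → ℝ} (hf : Measurable f) {m R : ℝ}
    (hR : ∀ x, |f x - m| ≤ R) :
    |(∫ x, f x ∂μ) - ∫ x, f x ∂ν| ≤ 2 * R * tvDist μ ν := by
  obtain ⟨x₀⟩ : Nonempty S := nonempty_of_isProbabilityMeasure μ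
  have hR0 : 0 ≤ R := (abs_nonneg _).trans (hR x₀)
  set g : S → ℝ := fun x => f x - m + R with hg
  have hgm : Measurable g := (hf.sub_const m).add_const R
  have hg0 : ∀ x, 0 ≤ g x := fun x => by
    have := (abs_le.1 (hR x)).1
    simp only [hg]; linarith
  have hgR : ∀ x, g x ≤ 2 * R := fun x => by
    have := (abs_le.1 (hR x)).2
    simp only [hg]; linarith
  have hgi : ∀ (σ : Measure S) [IsProbabilityMeasure σ], Integrable g σ := fun σ _ =>
    Integrable.of_bound hgm.aestronglyMeasurable (2 * R) (ae_of_all _ fun x => by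
      rw [Real.norm_eq_abs, abs_of_nonneg (hg0 x)]; exact hgR x)
  have hfg : ∀ (σ : Measure S) [IsProbabilityMeasure σ],
      ∫ x, f x ∂σ = (∫ t in Set.Ioc 0 (2 * R), σ.real {x | t ≤ g x}) + (m - R) := by
    intro σ _
    rw [← (hgi σ).integral_eq_integral_Ioc_meas_le (ae_of_all _ hg0) (ae_of_all _ hgR)]
    have : ∀ x, f x = g x + (m - R) := fun x => by simp only [hg]; ring
    simp_rw [this]
    rw [integral_add (hgi σ) (integrable_const _)]
    simp
  have hint : ∀ (σ : Measure S) [IsProbabilityMeasure σ],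
      IntegrableOn (fun t => σ.real {x | t ≤ g x}) (Set.Ioc 0 (2 * R)) := by
    intro σ _
    have hanti : Antitone fun t => σ.real {x | t ≤ g x} := fun s t hst =>
      measureReal_mono fun x hx => hst.trans hx
    exact (hanti.antitoneOn _).integrableOn_isCompact isCompact_Icc |>.mono_set
      Set.Ioc_subset_Icc_self
  rw [hfg μ, hfg ν, add_sub_add_right_eq_sub, ← integral_sub (hint μ) (hint ν), ← Real.norm_eq_abs]
  have := norm_setIntegral_le_of_norm_le_const (μ := volume) (s := Set.Ioc 0 (2 * R))
    (f := fun t => μ.real {x | t ≤ g x} - ν.real {x | t ≤ g x}) (C := tvDist μ ν)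
    measure_Ioc_lt_top (fun t _ => abs_measureReal_sub_le_tvDist μ ν (measurableSet_le measurable_const hgm))
  refine this.trans_eq ?_
  rw [Real.volume_real_Ioc_of_le (by linarith)]
  ring

variable (p : Kernel (S × A) S) (π : Kernel S A)

instance instIsMarkovKernelPolicyKernel [IsMarkovKernel p] [IsMarkovKernel π] :
    IsMarkovKernel (policyKernel p π) := by
  unfold policyKernel; infer_instance

instance instIsMarkovKernelStepKernel [IsMarkovKernel p] [IsMarkovKernel π] (t : ℕ) : IsMarkovKernel (stepKernel p π t) := by
  induction t with
  | zero => unfold stepKernel; infer_instance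
  | succ t ih => unfold stepKernel; infer_instance

theorem stepKernel_add (i j : ℕ) :
    stepKernel p π (i + j) = (stepKernel p π j).comp (stepKernel p π i) := by
  induction j with
  | zero => simp [stepKernel]
  | succ j ih =>
    rw [← add_assoc, stepKernel, stepKernel, ih, Kernel.comp_assoc]

theorem invariant_stepKernel {ξ : Measure S} (hξ : Kernel.Invariant (policyKernel p π) ξ)
    (t : ℕ) : Kernel.Invariant (stepKernel p π t) ξ := by
  induction t with
  | zero => simp [stepKernel, Kernel.Invariant]
  | succ t ih => rw [stepKernel]; exact hξ.comp ih

variable {p π}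

/-- The supremum over policies dominates the given one, a finite infimum in `ℕ∞` is attained, and
being mixed from `t` persists for every later time. -/
theorem one_le_and_isMixedFrom_of_worstMixingTime_eq {T : ℕ}
    (hT : worstMixingTime p = (T : ℕ∞)) (π : Kernel S A) [hπ : IsMarkovKernel π] :
    1 ≤ T ∧ IsMixedFrom p π T := by
  have h1 : policyMixingTime p π ≤ T := by
    rw [← hT]
    exact le_iSup (fun π : {π : Kernel S A // IsMarkovKernel π} => policyMixingTime p π.1) ⟨π, hπ⟩
  have h2 : policyMixingTime p π < (T + 1 : ℕ) := by
    refine h1.trans_lt ?_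
    exact_mod_cast Nat.lt_succ_self T
  simp only [policyMixingTime, iInf_lt_iff] at h2
  obtain ⟨t, ⟨ht1, ν, hν, hinv, hmix⟩, htT⟩ := h2
  have htT : t ≤ T := Nat.lt_succ_iff.1 (by exact_mod_cast htT)
  exact ⟨ht1.trans htT, ν, hν, hinv, fun t' ht' => hmix t' (htT.trans ht')⟩

variable [IsMarkovKernel p] [IsMarkovKernel π]

theorem measurable_integral_kernel {κ : Kernel S S} [IsMarkovKernel κ] {f : S → ℝ}
    (hf : Measurable f) : Measurable fun x => ∫ y, f y ∂(κ x) :=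
  (hf.stronglyMeasurable.integral_kernel (κ := κ)).measurable

theorem abs_integral_sub_le {μ : Measure S} [IsProbabilityMeasure μ] {f : S → ℝ}
    (hf : Measurable f) {m R : ℝ} (hR : ∀ x, |f x - m| ≤ R) : |(∫ x, f x ∂μ) - m| ≤ R := by
  have h1 : (∫ x, f x ∂μ) - m = ∫ x, (f x - m) ∂μ := by
    rw [integral_sub (integrable_of_abs_sub_le hf hR) (integrable_const m)]; simp
  rw [h1, ← Real.norm_eq_abs]
  simpa using norm_integral_le_of_norm_le_const (μ := μ) (f := fun x => f x - m) (ae_of_all _ hR)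

/-- Each block of mixing-time length halves the distance of `P^t f` to the constants. -/
theorem exists_abs_integral_stepKernel_sub_le {T : ℕ} (hT : IsMixedFrom p π T) {f : S → ℝ}
    (hf : Measurable f) {m R : ℝ} (hR : ∀ x, |f x - m| ≤ R) (k : ℕ) :
    ∃ c : ℝ, ∀ x, |(∫ y, f y ∂(stepKernel p π (k * T) x)) - c| ≤ (1 / 2) ^ k * R := by
  induction k with
  | zero =>
    refine ⟨m, fun x => ?_⟩
    rw [zero_mul, stepKernel, Kernel.id_apply, integral_dirac' _ _ hf.stronglyMeasurable]
    simpa using hR x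
  | succ k ih =>
    obtain ⟨c, hc⟩ := ih
    obtain ⟨ν, hν, -, hmix⟩ := hT
    set g : S → ℝ := fun x => ∫ y, f y ∂(stepKernel p π (k * T) x)
    have hg : Measurable g := measurable_integral_kernel hf
    -- The new centre is the `ν`-mean of `g`. A function within `ρ` of a constant has means
    -- differing by at most `2 ρ · (1/4) = ρ / 2`.
    refine ⟨∫ x, g x ∂ν, fun x => ?_⟩
    have h1 : ∫ y, f y ∂(stepKernel p π ((k + 1) * T) x) = ∫ y, g y ∂(stepKernel p π T x) := by
      rw [add_mul, one_mul, add_comm, stepKernel_add, Kernel.integral_comp]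
      exact integrable_of_abs_sub_le hf hR
    rw [h1]
    obtain ⟨x₀⟩ : Nonempty S := ⟨x⟩
    have hR0 : 0 ≤ (1 / 2) ^ k * R := (abs_nonneg _).trans (hc x)
    have h2 := abs_integral_sub_integral_le_tvDist (stepKernel p π T x) ν hg hc
    have h3 := hmix T le_rfl x
    calc _ ≤ _ := h2
      _ ≤ 2 * ((1 / 2) ^ k * R) * (1 / 4) := by gcongr
      _ = _ := by ring

theorem integral_eq_of_invariant {ξ : Measure S} [IsProbabilityMeasure ξ] {κ : Kernel S S}
    [IsMarkovKernel κ] (hξ : Kernel.Invariant κ ξ) {f : S → ℝ} (hf : Integrable f ξ) :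
    ∫ x, ∫ y, f y ∂(κ x) ∂ξ = ∫ x, f x ∂ξ := by
  have h := Kernel.integral_comp (κ := Kernel.const Unit ξ) (η := κ) (a := ()) (f := f)
    (by rwa [Kernel.comp_apply, Kernel.const_apply, hξ.def])
  rw [Kernel.comp_apply, Kernel.const_apply, hξ.def] at h
  exact h.symm

/-- Averaging over the invariant `ξ` shows that `∫ f ∂ξ` is as close to the unknown centre as the
conditional means are; hence the factor `2`. In particular `ξ` need not be identified with the law
in the definition of mixing. -/
theorem abs_integral_stepKernel_sub_integral_le {T : ℕ} (hT : IsMixedFrom p π T)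
    {ξ : Measure S} [IsProbabilityMeasure ξ] (hξ : Kernel.Invariant (policyKernel p π) ξ)
    {f : S → ℝ} (hf : Measurable f) {m R : ℝ} (hR : ∀ x, |f x - m| ≤ R) (k : ℕ) (x : S) :
    |(∫ y, f y ∂(stepKernel p π (k * T) x)) - ∫ y, f y ∂ξ| ≤ 2 * ((1 / 2) ^ k * R) := by
  obtain ⟨c, hc⟩ := exists_abs_integral_stepKernel_sub_le hT hf hR k
  have h1 := abs_integral_sub_le (μ := ξ) (measurable_integral_kernel hf) hc
  rw [integral_eq_of_invariant (invariant_stepKernel p π hξ _)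
    (integrable_of_abs_sub_le hf hR)] at h1
  have h2 := hc x
  rw [abs_le] at *
  constructor <;> linarith

end Mixing

/-! ### The Markov property along the path -/

section Path

variable {S A Ω : Type*} [MeasurableSpace S] [MeasurableSpace A]

/-- The σ-algebra generated by the path up to, and including, the `i`-th state. -/
abbrev pathSigma (s : ℕ → Ω → S) (a : ℕ → Ω → A) (i : ℕ) : MeasurableSpace Ω :=
  MeasurableSpace.comap (fun ω => (history s a i ω, s i ω)) inferInstance

variable {s : ℕ → Ω → S} {a : ℕ → Ω → A}

theorem measurable_pathSigma_history (i : ℕ) : Measurable[pathSigma s a i] (history s a i) :=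
  measurable_fst.comp (comap_measurable fun ω => (history s a i ω, s i ω))

theorem measurable_pathSigma_action {i j : ℕ} (h : j < i) : Measurable[pathSigma s a i] (a j) :=
  measurable_snd.comp ((measurable_pi_apply (⟨j, h⟩ : Fin i)).comp
    (measurable_pathSigma_history (s := s) (a := a) i))

theorem measurable_pathSigma_state {i j : ℕ} (h : j ≤ i) : Measurable[pathSigma s a i] (s j) := by
  rcases h.eq_or_lt with rfl | h
  · exact measurable_snd.comp (comap_measurable fun ω => (history s a j ω, s j ω))
  · exact measurable_fst.comp ((measurable_pi_apply (⟨j, h⟩ : Fin i)).comp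
      (measurable_pathSigma_history (s := s) (a := a) i))

theorem pathSigma_mono {i j : ℕ} (h : i ≤ j) : pathSigma s a i ≤ pathSigma s a j := by
  have hh : Measurable[pathSigma s a j] (history s a i) := by
    refine @measurable_pi_lambda _ _ _ (pathSigma s a j) _ _ fun k => ?_
    exact (measurable_pathSigma_state (k.2.le.trans h)).prodMk
      (measurable_pathSigma_action (k.2.trans_le h))
  exact (hh.prodMk (measurable_pathSigma_state h)).comap_le

variable [MeasurableSpace Ω] {P : Measure Ω} {p : Kernel (S × A) S} {π : Kernel S A} {n : ℕ}

theorem IsSamplePath.measurable_history (hpath : IsSamplePath P p π n s a) (i : ℕ) :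
    Measurable (history s a i) :=
  measurable_pi_lambda _ fun j =>
    (hpath.measurable_state j).prodMk (hpath.measurable_action j)

theorem IsSamplePath.pathSigma_le (hpath : IsSamplePath P p π n s a) (i : ℕ) :
    pathSigma s a i ≤ ‹MeasurableSpace Ω› := by
  rw [← measurable_iff_comap_le]
  exact (hpath.measurable_history i).prodMk (hpath.measurable_state i)

variable [IsProbabilityMeasure P] [IsMarkovKernel p] [IsMarkovKernel π]

/-- Markov property for one transition: `G` factors through the history and the current state, so
the next state and then the action can be integrated out. Working in `ℝ≥0∞` avoids integrability
conditions. -/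
theorem IsSamplePath.lintegral_mul_transition (hpath : IsSamplePath P p π n s a) {i : ℕ}
    (hi : i < n) {G : Ω → ℝ≥0∞} (hG : Measurable[pathSigma s a i] G) {h : S × A × S → ℝ≥0∞}
    (hh : Measurable h) :
    ∫⁻ ω, G ω * h (s i ω, a i ω, s (i + 1) ω) ∂P =
      ∫⁻ ω, G ω * ∫⁻ z, h (s i ω, z) ∂((π.compProd p) (s i ω)) ∂P := by
  obtain ⟨g, hg, rfl⟩ := hG.exists_eq_measurable_comp
  have hstate := hpath.measurable_state
  have haction := hpath.measurable_action
  have hhist := hpath.measurable_history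
  set T₁ : (Fin (i + 1) → S × A) × S → ℝ≥0∞ := fun x =>
    g (fun j => x.1 j.castSucc, (x.1 (Fin.last i)).1) *
      h ((x.1 (Fin.last i)).1, (x.1 (Fin.last i)).2, x.2) with hT₁
  have hT₁m : Measurable T₁ := by fun_prop
  set h₂ : S × A → ℝ≥0∞ := fun x => ∫⁻ s', h (x.1, x.2, s') ∂(p x) with hh₂
  have hh₂m : Measurable h₂ := by
    refine Measurable.lintegral_kernel_prod_right' (f := fun y : (S × A) × S =>
      h (y.1.1, y.1.2, y.2)) (by fun_prop)
  set T₂ : ((Fin i → S × A) × S) × A → ℝ≥0∞ := fun x => g x.1 * h₂ (x.1.2, x.2) with hT₂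
  have hT₂m : Measurable T₂ := by fun_prop
  calc ∫⁻ ω, (g ∘ fun ω => (history s a i ω, s i ω)) ω * h (s i ω, a i ω, s (i + 1) ω) ∂P
      = ∫⁻ x, T₁ x ∂(P.map fun ω => (history s a (i + 1) ω, s (i + 1) ω)) := by
        rw [lintegral_map hT₁m ((hhist _).prodMk (hstate _))]
        rfl
    _ = ∫⁻ ω, ∫⁻ s', T₁ (history s a (i + 1) ω, s') ∂(p (s i ω, a i ω)) ∂P := by
        rw [hpath.state_law i hi, Measure.lintegral_compProd hT₁m, lintegral_map _ (hhist _)]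
        · rfl
        · exact hT₁m.lintegral_kernel_prod_right'
    _ = ∫⁻ ω, T₂ ((history s a i ω, s i ω), a i ω) ∂P := by
        refine lintegral_congr fun ω => ?_
        exact lintegral_const_mul (μ := p (s i ω, a i ω)) (f := fun s' => h (s i ω, a i ω, s'))
          (g (history s a i ω, s i ω)) (by fun_prop)
    _ = ∫⁻ x, T₂ x ∂(P.map fun ω => ((history s a i ω, s i ω), a i ω)) := by
        rw [lintegral_map hT₂m (((hhist _).prodMk (hstate _)).prodMk (haction _))]
    _ = ∫⁻ ω, ∫⁻ a', T₂ ((history s a i ω, s i ω), a') ∂(π (s i ω)) ∂P := by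
        rw [hpath.action_law i hi, Measure.lintegral_compProd hT₂m,
          lintegral_map _ ((hhist _).prodMk (hstate _))]
        · rfl
        · exact hT₂m.lintegral_kernel_prod_right'
    _ = _ := by
        refine lintegral_congr fun ω => ?_
        rw [Kernel.lintegral_compProd _ _ _ (by fun_prop)]
        exact lintegral_const_mul (μ := π (s i ω)) (f := fun a' => h₂ (s i ω, a'))
          (g (history s a i ω, s i ω)) (by fun_prop)

/-- Markov property over a gap: the last transition is peeled off, which replaces `h` by its
one-step conditional mean. -/
theorem IsSamplePath.lintegral_mul_state (hpath : IsSamplePath P p π n s a) {i g : ℕ}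
    (hi : i + g ≤ n) {G : Ω → ℝ≥0∞} (hG : Measurable[pathSigma s a i] G) {h : S → ℝ≥0∞}
    (hh : Measurable h) :
    ∫⁻ ω, G ω * h (s (i + g) ω) ∂P =
      ∫⁻ ω, G ω * ∫⁻ y, h y ∂(stepKernel p π g (s i ω)) ∂P := by
  induction g generalizing h with
  | zero => simp [stepKernel, Kernel.id_apply, lintegral_dirac' _ hh]
  | succ g ih =>
    have h1 := hpath.lintegral_mul_transition (i := i + g) (by omega)
      (hG.mono (pathSigma_mono (Nat.le_add_right i g)) le_rfl)
      (h := fun x => h x.2.2) (by fun_prop)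
    rw [← add_assoc, h1]
    have h2 : ∀ x, ∫⁻ z, h z.2 ∂((π.compProd p) x) = ∫⁻ y, h y ∂(policyKernel p π x) := by
      intro x
      rw [policyKernel, Kernel.snd_apply, lintegral_map hh measurable_snd]
    simp_rw [h2]
    rw [ih (by omega) hh.lintegral_kernel]
    simp_rw [stepKernel, Kernel.lintegral_comp _ _ _ hh]

/-- If the conditional mean of `h(s_t, a_t, s_{t+1})`, given the state `g` steps before, is at
most `C`, then the mean of its product with a function of the path up to that time is at most
`C` times the mean of the latter. -/
theorem IsSamplePath.lintegral_mul_transition_le (hpath : IsSamplePath P p π n s a) {i g : ℕ}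
    (hi : i + g < n) {G : Ω → ℝ≥0∞} (hG : Measurable[pathSigma s a i] G)
    {h : S × A × S → ℝ≥0∞} (hh : Measurable h) {C : ℝ≥0∞}
    (hC : ∀ x, ∫⁻ y, ∫⁻ z, h (y, z) ∂((π.compProd p) y) ∂(stepKernel p π g x) ≤ C) :
    ∫⁻ ω, G ω * h (s (i + g) ω, a (i + g) ω, s (i + g + 1) ω) ∂P ≤ C * ∫⁻ ω, G ω ∂P := by
  rw [hpath.lintegral_mul_transition hi
    (hG.mono (pathSigma_mono (Nat.le_add_right i g)) le_rfl) hh,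
    hpath.lintegral_mul_state hi.le hG (h := fun y => ∫⁻ z, h (y, z) ∂((π.compProd p) y))
      (hh.lintegral_kernel_prod_right' (κ := π.compProd p)),
    ← lintegral_const_mul _ (hG.mono (hpath.pathSigma_le i) le_rfl)]
  refine lintegral_mono fun ω => ?_
  rw [mul_comm]
  gcongr
  exact hC _

end Path

/-! ### Conditional exponential moments and Chernoff's bound -/

section Concentration

variable {S A Ω : Type*} [MeasurableSpace S] [MeasurableSpace A] [MeasurableSpace Ω]
  {p : Kernel (S × A) S} [IsMarkovKernel p] {π : Kernel S A} [IsMarkovKernel π]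
  {ξ : Measure S} [IsProbabilityMeasure ξ]

theorem abs_sub_integral_le {X : Type*} [MeasurableSpace X] {J : Measure X}
    [IsProbabilityMeasure J] {f : X → ℝ} (hf : Measurable f) {B : ℝ} (hB : ∀ x, |f x| ≤ B)
    (x : X) : |f x - ∫ y, f y ∂J| ≤ 2 * B := by
  have h1 := abs_integral_sub_le (μ := J) hf (m := 0) (R := B) (by simpa using hB)
  rw [sub_zero] at h1
  have := abs_sub (f x) (∫ y, f y ∂J)
  linarith [hB x]

/-- The Bernstein bound for the moment generating function of a bounded variable. -/
theorem integral_exp_centered_le {X : Type*} [MeasurableSpace X] {J : Measure X}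
    [IsProbabilityMeasure J] {f : X → ℝ} (hf : Measurable f) {B V θ : ℝ}
    (hB : ∀ x, |f x| ≤ B) (hV : ∫ x, f x ^ 2 ∂J ≤ V) (hθ : 0 ≤ θ) (hθB : θ * B ≤ 1 / 4) :
    ∫ x, Real.exp (θ * (f x - ∫ y, f y ∂J)) ∂J ≤ 1 + θ ^ 2 * V := by
  set μ := ∫ y, f y ∂J with hμ
  have hz : ∀ x, |θ * (f x - μ)| ≤ 1 := fun x => by
    rw [abs_mul, abs_of_nonneg hθ]
    nlinarith [abs_sub_integral_le (J := J) hf hB x]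
  have hfi : Integrable f J := integrable_of_abs_sub_le hf (m := 0) (by simpa using hB)
  have hf2 : Integrable (fun x => f x ^ 2) J :=
    integrable_of_abs_sub_le (by fun_prop) (m := 0) (R := B ^ 2) (fun x => by
      rw [sub_zero, abs_pow]; exact pow_le_pow_left₀ (abs_nonneg _) (hB x) 2)
  have hexp : Integrable (fun x => Real.exp (θ * (f x - μ))) J :=
    integrable_of_abs_sub_le (by fun_prop) (m := 0) (R := Real.exp 1) (fun x => by
      rw [sub_zero, Real.abs_exp]
      exact Real.exp_le_exp.2 ((le_abs_self _).trans (hz x)))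
  calc ∫ x, Real.exp (θ * (f x - μ)) ∂J
      ≤ ∫ x, (θ ^ 2 * f x ^ 2 + ((θ - 2 * θ ^ 2 * μ) * f x + (1 - θ * μ + θ ^ 2 * μ ^ 2))) ∂J := by
        refine integral_mono hexp
          ((hf2.const_mul _).add ((hfi.const_mul _).add (integrable_const _))) fun x => ?_
        -- `exp z ≤ 1 + z + z²` for `|z| ≤ 1`, with `z = θ (f x - μ)`.
        have := (abs_le.1 (Real.abs_exp_sub_one_sub_id_le (hz x))).2
        simp only
        linarith
    _ = θ ^ 2 * (∫ x, f x ^ 2 ∂J) + ((θ - 2 * θ ^ 2 * μ) * μ + (1 - θ * μ + θ ^ 2 * μ ^ 2)) := by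
        have hlin : Integrable
            (fun x => (θ - 2 * θ ^ 2 * μ) * f x + (1 - θ * μ + θ ^ 2 * μ ^ 2)) J :=
          (hfi.const_mul _).add (integrable_const _)
        rw [integral_add (hf2.const_mul _) hlin,
          integral_add (hfi.const_mul _) (integrable_const _), integral_const_mul,
          integral_const_mul]
        simp [← hμ]
    _ ≤ 1 + θ ^ 2 * V := by nlinarith [sq_nonneg (θ * μ), sq_nonneg θ]

/-- The conditional moment generating function, `k` mixing times after the conditioning. -/
theorem lintegral_exp_stepKernel_le {T : ℕ} (hT : IsMixedFrom p π T)
    (hξ : Kernel.Invariant (policyKernel p π) ξ) {f : S × A × S → ℝ} (hf : Measurable f)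
    {B V θ : ℝ} (hB : ∀ x, |f x| ≤ B) (hV : ∫ x, f x ^ 2 ∂(ξ.compProd (π.compProd p)) ≤ V)
    (hθ : 0 ≤ θ) (hθB : θ * B ≤ 1 / 4) (k : ℕ) (x : S) :
    ∫⁻ y, ∫⁻ z, ENNReal.ofReal (Real.exp (θ * (f (y, z) -
        ∫ w, f w ∂(ξ.compProd (π.compProd p))))) ∂((π.compProd p) y) ∂(stepKernel p π (k * T) x)
      ≤ ENNReal.ofReal (Real.exp (θ ^ 2 * V + 8 * (1 / 2) ^ k * (θ * B))) := by
  set μ := ∫ w, f w ∂(ξ.compProd (π.compProd p)) with hμ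
  set F : S × A × S → ℝ := fun w => Real.exp (θ * (f w - μ)) with hF
  have hFm : Measurable F := by fun_prop
  -- Closeness of `F` to `1`, rather than mere boundedness, keeps the factor `θ B` in the mixing
  -- error.
  have hF1 : ∀ w, |F w - 1| ≤ 4 * (θ * B) := fun w => by
    have h1 : |θ * (f w - μ)| ≤ 2 * (θ * B) := by
      rw [abs_mul, abs_of_nonneg hθ]
      nlinarith [abs_sub_integral_le (J := ξ.compProd (π.compProd p)) hf hB w]
    have h2 := Real.abs_exp_sub_one_le (h1.trans (by linarith : 2 * (θ * B) ≤ 1))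
    linarith
  set H : S → ℝ := fun y => ∫ z, F (y, z) ∂((π.compProd p) y) with hH
  have hHm : Measurable H :=
    (hFm.stronglyMeasurable.integral_kernel_prod_right' (κ := π.compProd p)).measurable
  have hH1 : ∀ y, |H y - 1| ≤ 4 * (θ * B) := fun y =>
    abs_integral_sub_le (hFm.comp measurable_prodMk_left) fun z => hF1 (y, z)
  have hH0 : ∀ y, 0 ≤ H y := fun y => integral_nonneg fun z => (Real.exp_pos _).le
  have h1 : ∀ y, ∫⁻ z, ENNReal.ofReal (F (y, z)) ∂((π.compProd p) y) = ENNReal.ofReal (H y) := by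
    intro y
    rw [hH, ofReal_integral_eq_lintegral_ofReal _ (ae_of_all _ fun z => (Real.exp_pos _).le)]
    exact integrable_of_abs_sub_le (hFm.comp measurable_prodMk_left) fun z => hF1 (y, z)
  calc ∫⁻ y, ∫⁻ z, ENNReal.ofReal (F (y, z)) ∂((π.compProd p) y) ∂(stepKernel p π (k * T) x)
      = ENNReal.ofReal (∫ y, H y ∂(stepKernel p π (k * T) x)) := by
        simp_rw [h1]
        rw [ofReal_integral_eq_lintegral_ofReal (integrable_of_abs_sub_le hHm hH1)
          (ae_of_all _ hH0)]
    _ ≤ _ := ENNReal.ofReal_le_ofReal ?_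
  -- Mixing is applied to the conditional moment generating function `H`, within `4 θ B` of `1`: its
  -- mean after `k * T` steps differs from the stationary mean by at most `2 · 2 ^ -k · 4 θ B`.
  have h2 := (abs_le.1 (abs_integral_stepKernel_sub_integral_le hT hξ hHm hH1 k x)).2
  have h3 : ∫ y, H y ∂ξ ≤ 1 + θ ^ 2 * V := by
    rw [← Measure.integral_compProd (integrable_of_abs_sub_le hFm hF1)]
    exact integral_exp_centered_le hf hB hV hθ hθB
  have h4 := Real.add_one_le_exp (θ ^ 2 * V + 8 * (1 / 2) ^ k * (θ * B))
  linarith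

theorem sum_range_mul_eq_sum_residues (g : ℕ → ℝ) (M τ : ℕ) :
    ∑ i ∈ Finset.range (M * τ), g i =
      ∑ j ∈ Finset.range τ, ∑ q ∈ Finset.range M, g (j + q * τ) := by
  induction M with
  | zero => simp
  | succ M ih =>
    rw [add_mul, one_mul, Finset.sum_range_add, ih, ← Finset.sum_add_distrib]
    refine Finset.sum_congr rfl fun j _ => ?_
    rw [Finset.sum_range_succ, add_comm j]

variable {P : Measure Ω} [IsProbabilityMeasure P] {n : ℕ} {s : ℕ → Ω → S} {a : ℕ → Ω → A}

/-- The centered observation `h(s_t, a_t, s_{t+1})`, set to zero after the end of the path. -/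
def pathTerm (n : ℕ) (s : ℕ → Ω → S) (a : ℕ → Ω → A) (h : S × A × S → ℝ) (t : ℕ) (ω : Ω) : ℝ :=
  if t < n then h (s t ω, a t ω, s (t + 1) ω) else 0

omit [MeasurableSpace Ω] in
theorem measurable_pathSigma_pathTerm {h : S × A × S → ℝ} (hh : Measurable h) {t i : ℕ}
    (hi : t < i) : Measurable[pathSigma s a i] (pathTerm n s a h t) := by
  unfold pathTerm
  split_ifs
  · exact hh.comp ((measurable_pathSigma_state hi.le).prodMk
      ((measurable_pathSigma_action hi).prodMk (measurable_pathSigma_state hi)))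
  · exact measurable_const

/-- The first factor of a class has no gap before it and gets the uniform bound `C₀`; each later one
is conditioned on the path through the preceding observation and contributes `c`. -/
theorem IsSamplePath.lintegral_prod_exp_le (hpath : IsSamplePath P p π n s a)
    {h : S × A × S → ℝ} (hh : Measurable h) {θ C₀ c : ℝ} {g : ℕ} (hc : 0 ≤ c) (hC₀ : 0 ≤ C₀)
    (hθh : ∀ x, θ * h x ≤ C₀)
    (hC : ∀ x, ∫⁻ y, ∫⁻ z, ENNReal.ofReal (Real.exp (θ * h (y, z))) ∂((π.compProd p) y)
      ∂(stepKernel p π g x) ≤ ENNReal.ofReal (Real.exp c)) (j N : ℕ) :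
    ∫⁻ ω, ∏ q ∈ Finset.range (N + 1),
        ENNReal.ofReal (Real.exp (θ * pathTerm n s a h (j + q * (g + 1)) ω)) ∂P ≤
      ENNReal.ofReal (Real.exp (C₀ + N * c)) := by
  induction N with
  | zero =>
    calc _ ≤ ∫⁻ _, ENNReal.ofReal (Real.exp C₀) ∂P := by
          refine lintegral_mono fun ω => ?_
          simp only [zero_add, Finset.range_one, Finset.prod_singleton]
          gcongr
          unfold pathTerm
          split_ifs
          · exact hθh _
          · simpa using hC₀
      _ = _ := by simp
  | succ N ih =>
    have hstep : ENNReal.ofReal (Real.exp (C₀ + (N + 1 : ℕ) * c)) =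
        ENNReal.ofReal (Real.exp c) * ENNReal.ofReal (Real.exp (C₀ + N * c)) := by
      rw [← ENNReal.ofReal_mul (Real.exp_pos _).le, ← Real.exp_add]
      push_cast
      ring_nf
    rw [hstep]
    refine le_trans ?_ (mul_le_mul_right ih _)
    simp_rw [Finset.prod_range_succ _ (N + 1)]
    by_cases hlt : j + (N + 1) * (g + 1) < n
    · have hidx : j + (N + 1) * (g + 1) = (j + N * (g + 1) + 1) + g := by ring
      have := hpath.lintegral_mul_transition_le (i := j + N * (g + 1) + 1) (g := g)
        (by rwa [← hidx])
        (G := fun ω => ∏ q ∈ Finset.range (N + 1),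
          ENNReal.ofReal (Real.exp (θ * pathTerm n s a h (j + q * (g + 1)) ω)))
        (by
          refine Finset.measurable_fun_prod _ fun q hq => ?_
          have hq' : j + q * (g + 1) < j + N * (g + 1) + 1 := by
            have := Nat.mul_le_mul_right (g + 1) (Nat.lt_succ_iff.1 (Finset.mem_range.1 hq))
            omega
          exact ENNReal.measurable_ofReal.comp (Real.measurable_exp.comp
            ((measurable_pathSigma_pathTerm hh hq').const_mul θ)))
        (h := fun x => ENNReal.ofReal (Real.exp (θ * h x))) (by fun_prop) hC
      simp_rw [pathTerm, if_pos hlt]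
      rw [← hidx] at this
      exact this
    -- Past the end of the path the padded factor equals `1`, which is at most `exp c`.
    · simp_rw [pathTerm, if_neg hlt, mul_zero, Real.exp_zero, ENNReal.ofReal_one, mul_one]
      refine le_mul_of_one_le_left zero_le ?_
      rw [← ENNReal.ofReal_one]
      exact ENNReal.ofReal_le_ofReal (Real.one_le_exp hc)

/-- Chernoff's bound for the sum of the observations, via the classes modulo `g + 1`. -/
theorem IsSamplePath.measure_sum_ge_le (hpath : IsSamplePath P p π n s a)
    {h : S × A × S → ℝ} (hh : Measurable h) {θ C₀ c : ℝ} {g : ℕ} (hθ : 0 ≤ θ) (hc : 0 ≤ c)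
    (hC₀ : 0 ≤ C₀) (hθh : ∀ x, θ * h x ≤ C₀)
    (hC : ∀ x, ∫⁻ y, ∫⁻ z, ENNReal.ofReal (Real.exp (θ * h (y, z))) ∂((π.compProd p) y)
      ∂(stepKernel p π g x) ≤ ENNReal.ofReal (Real.exp c)) (t : ℝ) :
    P {ω | n * t ≤ ∑ i ∈ Finset.range n, h (s i ω, a i ω, s (i + 1) ω)} ≤
      ENNReal.ofReal (Real.exp (C₀ + n / (g + 1) * c - θ * (n * t) / (g + 1))) := by
  set N := n / (g + 1) with hN
  have hτ : (0 : ℝ) < g + 1 := by positivity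
  have hnN : n ≤ (N + 1) * (g + 1) := ((Nat.div_lt_iff_lt_mul g.succ_pos).1 N.lt_succ_self).le
  set Φ : Ω → ℝ≥0∞ := fun ω => ENNReal.ofReal (1 / (g + 1)) * ∑ j ∈ Finset.range (g + 1),
    ∏ q ∈ Finset.range (N + 1),
      ENNReal.ofReal (Real.exp (θ * pathTerm n s a h (j + q * (g + 1)) ω)) with hΦ
  have hterm : ∀ i, Measurable (pathTerm n s a h i) := fun i =>
    (measurable_pathSigma_pathTerm hh (Nat.lt_succ_self i)).mono (hpath.pathSigma_le _) le_rfl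
  have hΦm : Measurable Φ := by fun_prop
  have hΦint : ∫⁻ ω, Φ ω ∂P ≤ ENNReal.ofReal (Real.exp (C₀ + N * c)) := by
    rw [hΦ, lintegral_const_mul _ (by fun_prop), lintegral_finsetSum _ (by fun_prop)]
    calc _ ≤ ENNReal.ofReal (1 / (g + 1)) * ∑ j ∈ Finset.range (g + 1),
          ENNReal.ofReal (Real.exp (C₀ + N * c)) := by
          gcongr with j hj
          exact hpath.lintegral_prod_exp_le hh hc hC₀ hθh hC j N
      _ = _ := by
          rw [Finset.sum_const, Finset.card_range, nsmul_eq_mul, ← mul_assoc,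
            ← ENNReal.ofReal_natCast, ← ENNReal.ofReal_mul (by positivity)]
          push_cast
          rw [one_div_mul_cancel hτ.ne', ENNReal.ofReal_one, one_mul]
  have hjensen : ∀ ω, ENNReal.ofReal (Real.exp (θ / (g + 1) *
      ∑ i ∈ Finset.range n, h (s i ω, a i ω, s (i + 1) ω))) ≤ Φ ω := by
    intro ω
    have h1 : ∑ i ∈ Finset.range n, h (s i ω, a i ω, s (i + 1) ω) =
        ∑ j ∈ Finset.range (g + 1), ∑ q ∈ Finset.range (N + 1),
          pathTerm n s a h (j + q * (g + 1)) ω := by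
      rw [← sum_range_mul_eq_sum_residues (fun i => pathTerm n s a h i ω),
        ← Finset.sum_subset (Finset.range_mono hnN)]
      · exact Finset.sum_congr rfl fun i hi => by rw [pathTerm, if_pos (Finset.mem_range.1 hi)]
      · intro i _ hi
        rw [pathTerm, if_neg (fun h => hi (Finset.mem_range.2 h))]
    -- Jensen over the `g + 1` classes: they may depend on each other arbitrarily, since the
    -- exponential of the average of the class sums is at most the average of the exponentials.
    have h2 := convexOn_exp.map_sum_le (t := Finset.range (g + 1)) (w := fun _ => 1 / ((g : ℝ) + 1))
      (p := fun j => θ * ∑ q ∈ Finset.range (N + 1), pathTerm n s a h (j + q * (g + 1)) ω)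
      (fun _ _ => by positivity) (by simp [mul_inv_cancel₀ hτ.ne']) (fun _ _ => Set.mem_univ _)
    simp only [smul_eq_mul] at h2
    have h3 : θ / (g + 1) * ∑ i ∈ Finset.range n, h (s i ω, a i ω, s (i + 1) ω) =
        ∑ j ∈ Finset.range (g + 1), 1 / ((g : ℝ) + 1) *
          (θ * ∑ q ∈ Finset.range (N + 1), pathTerm n s a h (j + q * (g + 1)) ω) := by
      rw [h1, Finset.mul_sum]
      exact Finset.sum_congr rfl fun j _ => by ring
    rw [h3]
    refine (ENNReal.ofReal_le_ofReal h2).trans_eq ?_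
    rw [← Finset.mul_sum, ENNReal.ofReal_mul (by positivity),
      ENNReal.ofReal_sum_of_nonneg fun _ _ => (Real.exp_pos _).le]
    congr 1
    refine Finset.sum_congr rfl fun j _ => ?_
    rw [Finset.mul_sum, Real.exp_sum, ENNReal.ofReal_prod_of_nonneg fun _ _ => (Real.exp_pos _).le]
  set E := ENNReal.ofReal (Real.exp (θ * (n * t) / (g + 1))) with hE
  have hsub : {ω | n * t ≤ ∑ i ∈ Finset.range n, h (s i ω, a i ω, s (i + 1) ω)} ⊆
      {ω | E ≤ Φ ω} := by
    intro ω hω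
    refine le_trans (ENNReal.ofReal_le_ofReal (Real.exp_le_exp.2 ?_)) (hjensen ω)
    rw [mul_div_right_comm]
    exact mul_le_mul_of_nonneg_left hω (by positivity)
  have hE0 : E ≠ 0 := by simp [hE, Real.exp_pos]
  calc _ ≤ P {ω | E ≤ Φ ω} := measure_mono hsub
    _ ≤ (∫⁻ ω, Φ ω ∂P) / E := meas_ge_le_lintegral_div hΦm.aemeasurable hE0 ENNReal.ofReal_ne_top
    _ ≤ ENNReal.ofReal (Real.exp (C₀ + N * c)) / E := by gcongr
    _ = ENNReal.ofReal (Real.exp (C₀ + N * c - θ * (n * t) / (g + 1))) := by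
        rw [hE, ← ENNReal.ofReal_div_of_pos (Real.exp_pos _), ← Real.exp_sub]
    _ ≤ _ := by
        gcongr
        rw [le_div_iff₀ hτ]
        exact_mod_cast Nat.div_mul_le_self n (g + 1)

end Concentration

/-! ### Bernstein's inequality for one scalar observable -/

section Bernstein

/-- With `θ = t / (2V)` and `D = L log² x / x`, `x = n / T`, the gain is `θ t = 128 D`, the variance
term costs `θ² V = 64 D` and the mixing error at most `4 D`. So at least `60 D` is left, times `n /
m` for the spacing `m`. -/
theorem chernoff_exponent_le {T n k : ℕ} {B V L t : ℝ} (hT1 : 1 ≤ T) (hn : 2 * T ≤ n)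
    (hB0 : 0 ≤ B) (hV0 : 0 < V) (hL : 2 ≤ L)
    (ht : t = 16 * √(V * L * Real.log (n / T) ^ 2 / (n / T))) (htB : t * B ≤ V / 2)
    (hk : (2 : ℝ) ^ k ≤ n / T) (hk' : (n / T : ℝ) < 2 ^ (k + 1)) :
    2 * (t / (2 * V) * B) + n / (((k + 1) * T : ℕ) + 1) *
        ((t / (2 * V)) ^ 2 * V + 8 * (1 / 2) ^ (k + 1) * (t / (2 * V) * B)) -
      t / (2 * V) * (n * t) / (((k + 1) * T : ℕ) + 1) ≤ -(8 * L) := by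
  have hT0 : (0 : ℝ) < T := by exact_mod_cast hT1
  have hT1' : (1 : ℝ) ≤ T := by exact_mod_cast hT1
  set x : ℝ := n / T with hx
  have hnx : (n : ℝ) = x * T := by rw [hx, div_mul_cancel₀ _ hT0.ne']
  have hx2 : 2 ≤ x := by
    rw [hx, le_div_iff₀ hT0]
    exact_mod_cast hn
  have hx0 : 0 < x := by linarith
  set y := Real.log x with hy
  have hl1 : 0.69 < Real.log 2 := by linarith [Real.log_two_gt_d9]
  have hly : Real.log 2 ≤ y := Real.log_le_log two_pos hx2
  have hky : k * Real.log 2 ≤ y := by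
    rw [← Real.log_pow]
    exact Real.log_le_log (by positivity) hk
  have ht2 : t ^ 2 = 256 * (V * L * y ^ 2 / x) := by
    rw [ht, mul_pow, Real.sq_sqrt (by positivity)]
    norm_num
  have hθB : t / (2 * V) * B ≤ 1 / 4 := by
    rw [div_mul_eq_mul_div, div_le_iff₀ (by positivity)]
    linarith
  have ht0 : 0 ≤ t := by rw [ht]; positivity
  have hθB0 : 0 ≤ t / (2 * V) * B := by positivity
  set D : ℝ := L * y ^ 2 / x with hD
  have hquad : (t / (2 * V)) ^ 2 * V = 64 * D := by
    rw [div_pow, ht2, hD]; field_simp; ring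
  have hlin : t / (2 * V) * (n * t) = 128 * D * n := by
    rw [show t / (2 * V) * (n * t) = t ^ 2 / (2 * V) * n by ring, ht2, hD]; field_simp; ring
  have hpow : (1 / 2 : ℝ) ^ (k + 1) ≤ 1 / x := by
    rw [div_pow, one_pow]
    exact one_div_le_one_div_of_le hx0 hk'.le
  -- `L ≥ 2` and `log x ≥ log 2 > 0.69` give `L log² x ≥ 0.9`; this lets `D` absorb the mixing
  -- error, which is at most `2 / x`.
  have hDx : 0.9 / x ≤ D := by
    rw [hD]
    gcongr
    have hy2 : (0.69 : ℝ) ^ 2 ≤ y ^ 2 := pow_le_pow_left₀ (by norm_num) (hl1.le.trans hly) 2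
    have := mul_le_mul hL hy2 (by norm_num) (by linarith)
    linarith
  have hpert : 8 * (1 / 2) ^ (k + 1) * (t / (2 * V) * B) ≤ 4 * D := by
    have h1 : 8 * (1 / 2 : ℝ) ^ (k + 1) * (t / (2 * V) * B) ≤ 8 * (1 / x) * (1 / 4) := by gcongr
    have h2 : 8 * (1 / x) * (1 / 4) = 2 / 0.9 * (0.9 / x) := by ring
    have h3 : 0 < 0.9 / x := by positivity
    linarith
  set m : ℝ := ((k + 1) * T : ℕ) + 1 with hm
  have hm0 : 0 < m := by rw [hm]; positivity
  have hmle : m ≤ (k + 2) * T := by rw [hm]; push_cast; linarith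
  have hratio : x / (k + 2) ≤ n / m := by
    rw [div_le_div_iff₀ (by positivity) hm0, hnx]
    linarith [mul_le_mul_of_nonneg_left hmle hx0.le]
  -- As `m ≤ (k + 2) T` and `k ≤ log x / log 2`, the spacing loses only a logarithm. The result is
  -- `9 L` rather than `8 L`, to pay for the initial term `2 θ B ≤ 1/2`.
  have hmain : 9 * L ≤ n / m * (60 * D) := by
    have h1 : x / (k + 2) * (60 * D) = 60 * L * y ^ 2 / (k + 2) := by
      rw [hD]; field_simp
    have h2 : 9 * L ≤ 60 * L * y ^ 2 / (k + 2) := by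
      rw [le_div_iff₀ (by positivity)]
      have hk1 := mul_le_mul_of_nonneg_left hl1.le (Nat.cast_nonneg (α := ℝ) k)
      have hyy := mul_le_mul_of_nonneg_right (hl1.le.trans hly) (by linarith : 0 ≤ y)
      have hk2 : 9 * (k + 2 : ℝ) ≤ 60 * y ^ 2 := by linarith
      have := mul_le_mul_of_nonneg_left hk2 (by linarith : 0 ≤ L)
      linarith
    have h3 : x / (k + 2) * (60 * D) ≤ n / m * (60 * D) := by
      have : 0 ≤ D := by rw [hD]; positivity
      gcongr
    linarith
  have hnm : (0 : ℝ) ≤ n / m := by positivity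
  rw [hquad, hlin, show 128 * D * (n : ℝ) / m = n / m * (128 * D) by ring]
  have h1 := mul_le_mul_of_nonneg_left hpert hnm
  linarith

variable {S A Ω : Type*} [MeasurableSpace S] [MeasurableSpace A] [MeasurableSpace Ω]
  {p : Kernel (S × A) S} [IsMarkovKernel p] {π : Kernel S A} [IsMarkovKernel π]
  {ξ : Measure S} [IsProbabilityMeasure ξ]
  {P : Measure Ω} [IsProbabilityMeasure P] {n : ℕ} {s : ℕ → Ω → S} {a : ℕ → Ω → A}

/-- A Bernstein inequality along the path of a chain with mixing time at most `T`, from an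
arbitrary initial distribution. -/
theorem IsSamplePath.bernstein (hpath : IsSamplePath P p π n s a) {T : ℕ}
    (hT : IsMixedFrom p π T) (hT1 : 1 ≤ T) (hn : 2 * T ≤ n)
    (hξ : Kernel.Invariant (policyKernel p π) ξ) {f : S × A × S → ℝ} (hf : Measurable f)
    {B V L t : ℝ} (hB0 : 0 ≤ B) (hB : ∀ x, |f x| ≤ B)
    (hV : ∫ x, f x ^ 2 ∂(ξ.compProd (π.compProd p)) ≤ V) (hV0 : 0 < V) (hL : 2 ≤ L)
    (ht : t = 16 * √(V * L * Real.log (n / T) ^ 2 / (n / T))) (htB : t * B ≤ V / 2) :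
    P {ω | n * t ≤ ∑ i ∈ Finset.range n, (f (s i ω, a i ω, s (i + 1) ω) -
        ∫ w, f w ∂(ξ.compProd (π.compProd p)))} ≤ ENNReal.ofReal (Real.exp (-(8 * L))) := by
  have hT0 : (0 : ℝ) < T := by exact_mod_cast hT1
  have hx : (1 : ℝ) ≤ n / T := by
    rw [le_div_iff₀ hT0, one_mul]
    exact_mod_cast (by omega : T ≤ n)
  -- The gap will be `(k + 1) T`, the least multiple of `T` whose halvings bring the mixing error
  -- below `T / n`.
  obtain ⟨k, hk, hk'⟩ := exists_nat_pow_near hx one_lt_two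
  have ht0 : 0 ≤ t := by rw [ht]; positivity
  have hθ : 0 ≤ t / (2 * V) := by positivity
  have hθB : t / (2 * V) * B ≤ 1 / 4 := by
    rw [div_mul_eq_mul_div, div_le_iff₀ (by positivity)]
    linarith
  refine (hpath.measure_sum_ge_le (h := fun w => f w - ∫ w, f w ∂(ξ.compProd (π.compProd p)))
    (hf.sub_const _) (C₀ := 2 * (t / (2 * V) * B)) hθ (by positivity) (by positivity)
    (fun w => ?_) (lintegral_exp_stepKernel_le hT hξ hf hB hV hθ hθB (k + 1)) t).trans
    (ENNReal.ofReal_le_ofReal (Real.exp_le_exp.2 ?_))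
  · have := mul_le_mul_of_nonneg_left ((le_abs_self _).trans
      (abs_sub_integral_le (J := ξ.compProd (π.compProd p)) hf hB w)) hθ
    linarith
  · exact chernoff_exponent_le hT1 hn hB0 hV0 hL ht htB hk hk'

end Bernstein

/-! ### Tucker decompositions and finite feature families -/

theorem Tensor3.tuckerRank_le_of_eq_sum {p q d r l m : ℕ} {X : Tensor3 p q d} (c : Tensor3 r l m)
    (U : Fin p → Fin r → ℝ) (V : Fin q → Fin l → ℝ) (W : Fin d → Fin m → ℝ)
    (hX : ∀ i j k, X i j k = ∑ i', ∑ j', ∑ k', c i' j' k' * U i i' * V j j' * W k k') :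
    X.tuckerRank ≤ (r, l, m) := by
  -- Each matricization is a product whose left factor has only `r`, `l` or `m` columns.
  refine ⟨?_, ?_, ?_⟩
  · have : X.unfold1 = Matrix.of U * Matrix.of fun i' (jk : Fin q × Fin d) =>
        ∑ j', ∑ k', c i' j' k' * V jk.1 j' * W jk.2 k' := by
      ext i jk
      simp only [Tensor3.unfold1, Matrix.of_apply, Matrix.mul_apply, hX, Finset.mul_sum]
      refine Finset.sum_congr rfl fun i' _ => Finset.sum_congr rfl fun j' _ =>
        Finset.sum_congr rfl fun k' _ => by ring
    simp only [Tensor3.tuckerRank, this]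
    exact (Matrix.rank_mul_le_left _ _).trans ((Matrix.rank_le_card_width _).trans (by simp))
  · have : X.unfold2 = Matrix.of V * Matrix.of fun j' (ik : Fin p × Fin d) =>
        ∑ i', ∑ k', c i' j' k' * U ik.1 i' * W ik.2 k' := by
      ext j ik
      simp only [Tensor3.unfold2, Matrix.of_apply, Matrix.mul_apply, hX, Finset.mul_sum]
      rw [Finset.sum_comm]
      refine Finset.sum_congr rfl fun i' _ => Finset.sum_congr rfl fun j' _ =>
        Finset.sum_congr rfl fun k' _ => by ring
    simp only [Tensor3.tuckerRank, this]
    exact (Matrix.rank_mul_le_left _ _).trans ((Matrix.rank_le_card_width _).trans (by simp))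
  · have : X.unfold3 = Matrix.of W * Matrix.of fun k' (ij : Fin p × Fin q) =>
        ∑ i', ∑ j', c i' j' k' * U ij.1 i' * V ij.2 j' := by
      ext k ij
      simp only [Tensor3.unfold3, Matrix.of_apply, Matrix.mul_apply, hX, Finset.mul_sum]
      simp_rw [Finset.sum_comm (γ := Fin m)]
      refine Finset.sum_congr rfl fun i' _ => Finset.sum_congr rfl fun j' _ =>
        Finset.sum_congr rfl fun k' _ => by ring
    simp only [Tensor3.tuckerRank, this]
    exact (Matrix.rank_mul_le_left _ _).trans ((Matrix.rank_le_card_width _).trans (by simp))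

section Features

variable {X H : Type*} [NormedAddCommGroup H] [InnerProductSpace ℝ H] [RKHS ℝ H X ℝ]
  {d : ℕ} {φ : Fin d → H}

theorem inner_featureVec (u : EuclideanSpace ℝ (Fin d)) (x : X) :
    inner ℝ u (featureVec φ x) = ∑ i, u i * φ i x := by
  simp [featureVec, PiLp.inner_apply, mul_comm]

theorem measurable_inner_featureVec [MeasurableSpace X] (hφ : ∀ i, Measurable (φ i : X → ℝ))
    (u : EuclideanSpace ℝ (Fin d)) :
    Measurable fun x : X => (inner ℝ u (featureVec φ x) : ℝ) := by
  simp_rw [inner_featureVec]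
  fun_prop

variable [CompleteSpace H]

/-- The kernel section at `x` is `∑ i, φ i x • φ i`, so the reproducing property expands every `f`
in the features. Measurability and boundedness of all functions of the space, hence of the factors
in the rank decomposition, follow from those of the features. -/
theorem IsFeatureFamily.apply_eq_sum (hφ : IsFeatureFamily φ) (f : H) (x : X) :
    f x = ∑ i, inner ℝ f (φ i) * φ i x := by
  have h1 : RKHS.kerFun H x (1 : ℝ) = ∑ i, φ i x • φ i := by
    refine RKHS.ext fun y => ?_
    have h2 := hφ y x
    rw [realKernel] at h2
    have h3 : ∀ t : Finset (Fin d), (∑ i ∈ t, φ i x • φ i : H) y = ∑ i ∈ t, φ i x * φ i y := by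
      intro t
      induction t using Finset.induction_on with
      | empty => simp
      | insert i t hi ih => simp [Finset.sum_insert hi, ih]
    rw [RKHS.kerFun_apply, h2, h3]
    exact Finset.sum_congr rfl fun i _ => mul_comm _ _
  have h2 : inner ℝ f (RKHS.kerFun H x (1 : ℝ)) = f x := by
    rw [RKHS.inner_kerFun]; simp
  rw [← h2, h1, inner_sum]
  exact Finset.sum_congr rfl fun i _ => by rw [real_inner_smul_right, mul_comm]

theorem IsFeatureFamily.measurable [MeasurableSpace X] (hφ : IsFeatureFamily φ)
    (hm : ∀ i, Measurable (φ i : X → ℝ)) (f : H) : Measurable (f : X → ℝ) := by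
  rw [show (f : X → ℝ) = fun x => ∑ i, inner ℝ f (φ i) * φ i x from funext (hφ.apply_eq_sum f)]
  fun_prop

theorem IsFeatureFamily.norm_featureVec_sq (hφ : IsFeatureFamily φ) (x : X) :
    ‖featureVec φ x‖ ^ 2 = realKernel H x x := by
  rw [hφ x x, EuclideanSpace.norm_sq_eq]
  simp [featureVec, sq]

theorem IsFeatureFamily.norm_featureVec_le (hφ : IsFeatureFamily φ) {K : ℝ}
    (hK : ∀ x : X, realKernel H x x ≤ K) (x : X) : ‖featureVec φ x‖ ≤ √K :=
  Real.le_sqrt_of_sq_le ((hφ.norm_featureVec_sq x).trans_le (hK x))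

theorem IsFeatureFamily.abs_inner_le (hφ : IsFeatureFamily φ) {K : ℝ}
    (hK : ∀ x : X, realKernel H x x ≤ K) {u : EuclideanSpace ℝ (Fin d)} (hu : ‖u‖ = 1) (x : X) :
    |inner ℝ u (featureVec φ x)| ≤ √K := by
  have := abs_real_inner_le_norm u (featureVec φ x)
  rw [hu, one_mul] at this
  exact this.trans (hφ.norm_featureVec_le hK x)

theorem IsFeatureFamily.abs_apply_le (hφ : IsFeatureFamily φ) {K : ℝ}
    (hK : ∀ x : X, realKernel H x x ≤ K) (f : H) (x : X) :
    |f x| ≤ (∑ i, |inner ℝ f (φ i)|) * √K := by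
  rw [hφ.apply_eq_sum f x, Finset.sum_mul]
  refine (Finset.abs_sum_le_sum_abs _ _).trans (Finset.sum_le_sum fun i _ => ?_)
  rw [abs_mul]
  gcongr
  exact (PiLp.norm_apply_le (featureVec φ x) i).trans (hφ.norm_featureVec_le hK x)

end Features

/-! ### Importance weights, moments and rank of the mean embedding -/

section Model

variable {S A HS HA : Type*}
  [NormedAddCommGroup HS] [InnerProductSpace ℝ HS] [RKHS ℝ HS S ℝ]
  [NormedAddCommGroup HA] [InnerProductSpace ℝ HA] [RKHS ℝ HA A ℝ]
  {dS dA : ℕ} {φ : Fin dS → HS} {ψ : Fin dA → HA}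

variable (φ ψ) in
/-- The rank-one observation `(u · φ(s)) (v · ψ(a)) (w · φ(s'))`. -/
noncomputable def featureProd (u : EuclideanSpace ℝ (Fin dS)) (v : EuclideanSpace ℝ (Fin dA))
    (w : EuclideanSpace ℝ (Fin dS)) (x : S × A × S) : ℝ :=
  inner ℝ u (featureVec φ x.1) * inner ℝ v (featureVec ψ x.2.1) * inner ℝ w (featureVec φ x.2.2)

theorem featureProd_eq_sum (u : EuclideanSpace ℝ (Fin dS)) (v : EuclideanSpace ℝ (Fin dA))
    (w : EuclideanSpace ℝ (Fin dS)) (x : S × A × S) :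
    featureProd φ ψ u v w x =
      ∑ i, ∑ j, ∑ k, φ i x.1 * ψ j x.2.1 * φ k x.2.2 * (u i * v j * w k) := by
  rw [featureProd, inner_featureVec, inner_featureVec, inner_featureVec, Finset.sum_mul_sum,
    Finset.sum_mul]
  refine Finset.sum_congr rfl fun i _ => ?_
  rw [Finset.sum_mul_sum]
  exact Finset.sum_congr rfl fun j _ => Finset.sum_congr rfl fun k _ => by ring

theorem apply_importanceEstimate (e : A → ℝ≥0) (b : S → A → ℝ≥0) (n : ℕ) (s : ℕ → S) (a : ℕ → A)
    (u : EuclideanSpace ℝ (Fin dS)) (v : EuclideanSpace ℝ (Fin dA))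
    (w : EuclideanSpace ℝ (Fin dS)) :
    (importanceEstimate e b φ ψ n s a).apply u v w = (n : ℝ)⁻¹ * ∑ t ∈ Finset.range n,
      ((e (a t) : ℝ) / b (s t) (a t)) * featureProd φ ψ u v w (s t, a t, s (t + 1)) := by
  simp only [Tensor3.apply, importanceEstimate, featureProd_eq_sum, Finset.mul_sum,
    Finset.sum_mul]
  simp_rw [Finset.sum_comm (s := Finset.univ) (t := Finset.range n)]
  refine Finset.sum_congr rfl fun t _ => Finset.sum_congr rfl fun i _ =>
    Finset.sum_congr rfl fun j _ => Finset.sum_congr rfl fun k _ => by ring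

variable [MeasurableSpace S] [MeasurableSpace A]

theorem measurable_featureProd (hφm : ∀ i, Measurable (φ i : S → ℝ))
    (hψm : ∀ j, Measurable (ψ j : A → ℝ)) (u : EuclideanSpace ℝ (Fin dS))
    (v : EuclideanSpace ℝ (Fin dA)) (w : EuclideanSpace ℝ (Fin dS)) :
    Measurable (featureProd φ ψ u v w) :=
  (((measurable_inner_featureVec hφm u).comp measurable_fst).mul
    ((measurable_inner_featureVec hψm v).comp (measurable_fst.comp measurable_snd))).mul
    ((measurable_inner_featureVec hφm w).comp (measurable_snd.comp measurable_snd))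

variable {p : Kernel (S × A) S} [IsMarkovKernel p] {ξ : Measure S} [IsProbabilityMeasure ξ]
  {η : Measure A} [IsProbabilityMeasure η]

instance instIsProbabilityMeasureDecoupledLaw : IsProbabilityMeasure (decoupledLaw p ξ η) := by
  unfold decoupledLaw; infer_instance

/-- Importance weights turn the stationary law of a transition into the decoupled law. -/
theorem withDensity_ratio_eq {ρ : Measure A} [SigmaFinite ρ] {e : A → ℝ≥0}
    (he_meas : Measurable e) (hη : η = ρ.withDensity fun a => (e a : ℝ≥0∞)) {π : Kernel S A}
    [IsMarkovKernel π] {b : S → A → ℝ≥0} (hb_meas : Measurable (Function.uncurry b))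
    (hπ : ∀ s, π s = ρ.withDensity fun a => (b s a : ℝ≥0∞)) (hb : ∀ s a, b s a ≠ 0) :
    (ξ.compProd (π.compProd p)).withDensity
        (fun x => ((e x.2.1 / b x.1 x.2.1 : ℝ≥0) : ℝ≥0∞)) =
      (decoupledLaw p ξ η).map MeasurableEquiv.prodAssoc := by
  have hbm : ∀ s, Measurable (b s) := fun s => hb_meas.comp measurable_prodMk_left
  have hW : Measurable fun x : S × A => e x.2 / b x.1 x.2 :=
    (he_meas.comp measurable_snd).div hb_meas
  have hW' : Measurable fun x : S × A × S => ((e x.2.1 / b x.1 x.2.1 : ℝ≥0) : ℝ≥0∞) :=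
    (hW.comp (measurable_fst.prodMk (measurable_fst.comp measurable_snd))).coe_nnreal_ennreal
  refine Measure.ext_of_lintegral _ fun h hh => ?_
  have hin : Measurable fun x : S × A => ∫⁻ s', h (x.1, x.2, s') ∂(p x) :=
    Measurable.lintegral_kernel_prod_right' (f := fun y : (S × A) × S => h (y.1.1, y.1.2, y.2))
      (by fun_prop)
  rw [lintegral_withDensity_eq_lintegral_mul _ hW' hh,
    Measure.lintegral_compProd (hW'.mul hh), lintegral_map hh MeasurableEquiv.prodAssoc.measurable,
    decoupledLaw, Measure.lintegral_compProd (f := fun x => h (MeasurableEquiv.prodAssoc x))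
      (hh.comp MeasurableEquiv.prodAssoc.measurable),
    lintegral_prod _ ?_]
  swap
  · exact hin.aemeasurable
  refine lintegral_congr fun x => ?_
  set q : A → ℝ≥0∞ := fun y => ∫⁻ s', h (x, y, s') ∂(p (x, y)) with hq
  have hqm : Measurable q := hin.comp measurable_prodMk_left
  have hWx : Measurable fun y => ((e y / b x y : ℝ≥0) : ℝ≥0∞) :=
    (he_meas.div (hbm x)).coe_nnreal_ennreal
  calc ∫⁻ z, ((e z.1 / b x z.1 : ℝ≥0) : ℝ≥0∞) * h (x, z) ∂((π.compProd p) x)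
      = ∫⁻ y, ((e y / b x y : ℝ≥0) : ℝ≥0∞) * q y ∂(π x) := by
        have hm : Measurable fun z : A × S => ((e z.1 / b x z.1 : ℝ≥0) : ℝ≥0∞) * h (x, z) :=
          (hWx.comp measurable_fst).mul (hh.comp measurable_prodMk_left)
        rw [Kernel.lintegral_compProd _ _ _ hm]
        refine lintegral_congr fun y => ?_
        exact lintegral_const_mul (μ := p (x, y)) (f := fun s' => h (x, y, s'))
          ((e y / b x y : ℝ≥0) : ℝ≥0∞) (by fun_prop)
    _ = ∫⁻ y, (e y : ℝ≥0∞) * q y ∂ρ := by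
        have hm : Measurable fun y => ((e y / b x y : ℝ≥0) : ℝ≥0∞) * q y := hWx.mul hqm
        rw [hπ, lintegral_withDensity_eq_lintegral_mul _ (hbm x).coe_nnreal_ennreal hm]
        refine lintegral_congr fun y => ?_
        simp only [Pi.mul_apply]
        rw [← mul_assoc, ← ENNReal.coe_mul, mul_div_cancel₀ _ (hb x y)]
    _ = ∫⁻ y, q y ∂η := by
        rw [hη, lintegral_withDensity_eq_lintegral_mul _ he_meas.coe_nnreal_ennreal hqm]
        rfl

end Model

/-- Since `e` is positive, a zero of `b` would make the ratio infinite; finiteness of `κ` thus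
yields the overlap needed for the change of measure. -/
theorem ratio_ne_zero_and_le {S A : Type*} {e : A → ℝ≥0} {b : S → A → ℝ≥0}
    (he_pos : ∀ a, 0 < e a) (hκ : ratioSup e b ≠ ⊤) (s : S) (a : A) :
    b s a ≠ 0 ∧ (e a : ℝ) / b s a ≤ (ratioSup e b).toReal := by
  have h1 : (e a : ℝ≥0∞) / (b s a : ℝ≥0∞) ≤ ratioSup e b :=
    le_iSup₂ (f := fun (s : S) (a : A) => (e a : ℝ≥0∞) / (b s a : ℝ≥0∞)) s a
  have hb : b s a ≠ 0 := fun h => by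
    rw [h, ENNReal.coe_zero, ENNReal.div_zero (by simpa using (he_pos a).ne')] at h1
    exact hκ (top_le_iff.1 h1)
  refine ⟨hb, ?_⟩
  have := ENNReal.toReal_mono hκ h1
  simpa using this

section Model

variable {S A HS HA : Type*} [MeasurableSpace S] [MeasurableSpace A]
  [NormedAddCommGroup HS] [InnerProductSpace ℝ HS] [CompleteSpace HS] [RKHS ℝ HS S ℝ]
  [NormedAddCommGroup HA] [InnerProductSpace ℝ HA] [CompleteSpace HA] [RKHS ℝ HA A ℝ]
  {dS dA : ℕ} {φ : Fin dS → HS} {ψ : Fin dA → HA}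
  {p : Kernel (S × A) S} [IsMarkovKernel p] {ξ : Measure S} [IsProbabilityMeasure ξ]
  {η : Measure A} [IsProbabilityMeasure η] {K : ℝ}

omit [MeasurableSpace S] [MeasurableSpace A] in
theorem abs_featureProd_le (hφ : IsFeatureFamily φ) (hψ : IsFeatureFamily ψ)
    (hKS : ∀ s : S, realKernel HS s s ≤ K) (hKA : ∀ a : A, realKernel HA a a ≤ K)
    {u : EuclideanSpace ℝ (Fin dS)} {v : EuclideanSpace ℝ (Fin dA)}
    {w : EuclideanSpace ℝ (Fin dS)} (hu : ‖u‖ = 1) (hv : ‖v‖ = 1) (hw : ‖w‖ = 1)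
    (x : S × A × S) : |featureProd φ ψ u v w x| ≤ √K ^ 3 := by
  rw [featureProd, abs_mul, abs_mul, pow_succ, sq]
  gcongr
  · exact hφ.abs_inner_le hKS hu _
  · exact hψ.abs_inner_le hKA hv _
  · exact hφ.abs_inner_le hKS hw _

theorem integral_featureProd_sq_le_lambdaBar (hφm : ∀ i, Measurable (φ i : S → ℝ))
    (hψm : ∀ j, Measurable (ψ j : A → ℝ)) (hφ : IsFeatureFamily φ) (hψ : IsFeatureFamily ψ)
    (hKS : ∀ s : S, realKernel HS s s ≤ K) (hKA : ∀ a : A, realKernel HA a a ≤ K)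
    {u : EuclideanSpace ℝ (Fin dS)} {v : EuclideanSpace ℝ (Fin dA)}
    {w : EuclideanSpace ℝ (Fin dS)} (hu : ‖u‖ = 1) (hv : ‖v‖ = 1) (hw : ‖w‖ = 1) :
    ∫ x, featureProd φ ψ u v w x ^ 2 ∂((decoupledLaw p ξ η).map MeasurableEquiv.prodAssoc) ≤
      lambdaBar p ξ η φ ψ := by
  rw [integral_map_equiv]
  refine le_ciSup (f := fun y : USphere dS × USphere dA × USphere dS =>
    ∫ x, featureProd φ ψ y.1 y.2.1 y.2.2 (MeasurableEquiv.prodAssoc x) ^ 2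
      ∂(decoupledLaw p ξ η)) ⟨(√K ^ 3) ^ 2, ?_⟩
    (⟨u, by simpa using hu⟩, ⟨v, by simpa using hv⟩, ⟨w, by simpa using hw⟩)
  rintro _ ⟨⟨u', v', w'⟩, rfl⟩
  have h1 : ∀ x, |featureProd φ ψ u' v' w' x ^ 2 - 0| ≤ (√K ^ 3) ^ 2 := fun x => by
    rw [sub_zero, abs_pow]
    exact pow_le_pow_left₀ (abs_nonneg _) (abs_featureProd_le hφ hψ hKS hKA
      (by simp) (by simp) (by simp) x) 2
  have h2 := abs_integral_sub_le (μ := decoupledLaw p ξ η)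
    (((measurable_featureProd hφm hψm (u' : EuclideanSpace ℝ (Fin dS)) v' w').pow_const 2).comp
      MeasurableEquiv.prodAssoc.measurable) fun x => h1 (MeasurableEquiv.prodAssoc x)
  rw [sub_zero] at h2
  exact (le_abs_self _).trans h2

theorem integrable_feature_mul (hφm : ∀ i, Measurable (φ i : S → ℝ))
    (hψm : ∀ j, Measurable (ψ j : A → ℝ)) (hφ : IsFeatureFamily φ) (hψ : IsFeatureFamily ψ)
    (hKS : ∀ s : S, realKernel HS s s ≤ K) (hKA : ∀ a : A, realKernel HA a a ≤ K)
    (i : Fin dS) (j : Fin dA) (k : Fin dS) :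
    Integrable (fun x : (S × A) × S => φ i x.1.1 * ψ j x.1.2 * φ k x.2)
      (decoupledLaw p ξ η) := by
  refine integrable_of_abs_sub_le (m := 0)
    (R := ((∑ i', |inner ℝ (φ i) (φ i')|) * √K) * ((∑ j', |inner ℝ (ψ j) (ψ j')|) * √K) *
      ((∑ k', |inner ℝ (φ k) (φ k')|) * √K)) ?_ fun x => ?_
  · exact (((hφm i).comp (measurable_fst.comp measurable_fst)).mul
      ((hψm j).comp (measurable_snd.comp measurable_fst))).mul ((hφm k).comp measurable_snd)
  · rw [sub_zero, abs_mul, abs_mul]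
    gcongr
    · exact hφ.abs_apply_le hKS _ _
    · exact hψ.abs_apply_le hKA _ _
    · exact hφ.abs_apply_le hKS _ _

/-- The mean embedding, tested against a rank-one tensor. -/
theorem apply_meanEmbedding (hφm : ∀ i, Measurable (φ i : S → ℝ))
    (hψm : ∀ j, Measurable (ψ j : A → ℝ)) (hφ : IsFeatureFamily φ) (hψ : IsFeatureFamily ψ)
    (hKS : ∀ s : S, realKernel HS s s ≤ K) (hKA : ∀ a : A, realKernel HA a a ≤ K)
    (u : EuclideanSpace ℝ (Fin dS)) (v : EuclideanSpace ℝ (Fin dA))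
    (w : EuclideanSpace ℝ (Fin dS)) :
    (meanEmbedding p ξ η φ ψ).apply u v w =
      ∫ x, featureProd φ ψ u v w x ∂((decoupledLaw p ξ η).map MeasurableEquiv.prodAssoc) := by
  have hint := integrable_feature_mul hφm hψm hφ hψ hKS hKA (p := p) (ξ := ξ) (η := η)
  rw [integral_map_equiv]
  simp only [featureProd_eq_sum, Tensor3.apply, meanEmbedding, MeasurableEquiv.prodAssoc,
    MeasurableEquiv.coe_mk, Equiv.prodAssoc_apply]
  rw [integral_finsetSum _ fun i _ => integrable_finsetSum _ fun j _ =>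
    integrable_finsetSum _ fun k _ => (hint i j k).mul_const _]
  refine Finset.sum_congr rfl fun i _ => ?_
  rw [integral_finsetSum _ fun j _ =>
    integrable_finsetSum _ fun k _ => (hint i j k).mul_const _]
  refine Finset.sum_congr rfl fun j _ => ?_
  rw [integral_finsetSum _ fun k _ => (hint i j k).mul_const _]
  exact Finset.sum_congr rfl fun k _ => (integral_mul_const _ _).symm

/-- Conditioning on `(S, A)` replaces `φ k (S')` by the transition operator applied to `φ k`, a sum
of products of state and action functions. Independence of `S` and `A` under the decoupled law
factors their expectation, with core tensor the same `c`. -/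
theorem tuckerRank_meanEmbedding_le (hφm : ∀ i, Measurable (φ i : S → ℝ))
    (hψm : ∀ j, Measurable (ψ j : A → ℝ)) (hφ : IsFeatureFamily φ) (hψ : IsFeatureFamily ψ)
    (hKS : ∀ s : S, realKernel HS s s ≤ K) (hKA : ∀ a : A, realKernel HA a a ≤ K) {r l m : ℕ}
    (hrank : OperatorTuckerRankLE HS HA p r l m) :
    (meanEmbedding p ξ η φ ψ).tuckerRank ≤ (r, l, m) := by
  obtain ⟨c, u, v, w, hP⟩ := hrank
  refine Tensor3.tuckerRank_le_of_eq_sum c (fun i i' => ∫ s, φ i s * u i' s ∂ξ)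
    (fun j j' => ∫ a, ψ j a * v j' a ∂η) (fun k k' => inner ℝ (φ k) (w k')) fun i j k => ?_
  have hU : ∀ i', Integrable (fun s => φ i s * u i' s) ξ := fun i' =>
    integrable_of_abs_sub_le ((hφm i).mul (hφ.measurable hφm (u i'))) (m := 0)
      (R := ((∑ k, |inner ℝ (φ i) (φ k)|) * √K) * ((∑ k, |inner ℝ (u i') (φ k)|) * √K))
      fun x => by
        rw [sub_zero, abs_mul]
        gcongr
        exacts [hφ.abs_apply_le hKS _ _, hφ.abs_apply_le hKS _ _]
  have hV : ∀ j', Integrable (fun a => ψ j a * v j' a) η := fun j' =>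
    integrable_of_abs_sub_le ((hψm j).mul (hψ.measurable hψm (v j'))) (m := 0)
      (R := ((∑ k, |inner ℝ (ψ j) (ψ k)|) * √K) * ((∑ k, |inner ℝ (v j') (ψ k)|) * √K))
      fun x => by
        rw [sub_zero, abs_mul]
        gcongr
        exacts [hψ.abs_apply_le hKA _ _, hψ.abs_apply_le hKA _ _]
  have hint := integrable_feature_mul hφm hψm hφ hψ hKS hKA (p := p) (ξ := ξ) (η := η) i j k
  have hterm : ∀ i' j', Integrable (fun x : S × A => (φ i x.1 * u i' x.1) * (ψ j x.2 * v j' x.2))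
      (ξ.prod η) := fun i' j' => (hU i').mul_prod (hV j')
  calc meanEmbedding p ξ η φ ψ i j k
      = ∫ x, φ i x.1 * ψ j x.2 * ∫ s', φ k s' ∂(p x) ∂(ξ.prod η) := by
        rw [meanEmbedding, decoupledLaw, Measure.integral_compProd hint]
        simp only [integral_const_mul]
    _ = ∫ x : S × A, ∑ i', ∑ j', ∑ k', (c i' j' k' * inner ℝ (φ k) (w k')) *
          ((φ i x.1 * u i' x.1) * (ψ j x.2 * v j' x.2)) ∂(ξ.prod η) := by
        refine integral_congr_ae (ae_of_all _ fun x => ?_)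
        simp only [hP, Finset.mul_sum]
        refine Finset.sum_congr rfl fun i' _ => Finset.sum_congr rfl fun j' _ =>
          Finset.sum_congr rfl fun k' _ => by ring
    _ = _ := by
        rw [integral_finsetSum _ fun i' _ => integrable_finsetSum _ fun j' _ =>
          integrable_finsetSum _ fun k' _ => (hterm i' j').const_mul _]
        refine Finset.sum_congr rfl fun i' _ => ?_
        rw [integral_finsetSum _ fun j' _ =>
          integrable_finsetSum _ fun k' _ => (hterm i' j').const_mul _]
        refine Finset.sum_congr rfl fun j' _ => ?_
        rw [integral_finsetSum _ fun k' _ => (hterm i' j').const_mul _]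
        refine Finset.sum_congr rfl fun k' _ => ?_
        rw [integral_const_mul, integral_prod_mul (fun s => φ i s * u i' s)
          (fun a => ψ j a * v j' a)]
        ring

end Model

section Model

variable {S A HS HA : Type*} [MeasurableSpace S] [MeasurableSpace A]
  [NormedAddCommGroup HS] [InnerProductSpace ℝ HS] [CompleteSpace HS] [RKHS ℝ HS S ℝ]
  [NormedAddCommGroup HA] [InnerProductSpace ℝ HA] [CompleteSpace HA] [RKHS ℝ HA A ℝ]
  {dS dA : ℕ} {φ : Fin dS → HS} {ψ : Fin dA → HA}
  {p : Kernel (S × A) S} [IsMarkovKernel p] {ξ : Measure S} [IsProbabilityMeasure ξ]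
  {η : Measure A} [IsProbabilityMeasure η] {K : ℝ}
  {ρ : Measure A} [SigmaFinite ρ] {e : A → ℝ≥0} {b : S → A → ℝ≥0}
  {π : Kernel S A} [IsMarkovKernel π]

theorem integral_ratio_mul_eq (he_meas : Measurable e)
    (hη : η = ρ.withDensity fun a => (e a : ℝ≥0∞)) (hb_meas : Measurable (Function.uncurry b))
    (hπ : ∀ s, π s = ρ.withDensity fun a => (b s a : ℝ≥0∞)) (hb : ∀ s a, b s a ≠ 0)
    (h : S × A × S → ℝ) :
    ∫ x, ((e x.2.1 : ℝ) / b x.1 x.2.1) * h x ∂(ξ.compProd (π.compProd p)) =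
      ∫ x, h x ∂((decoupledLaw p ξ η).map MeasurableEquiv.prodAssoc) := by
  have hW : Measurable fun x : S × A × S => e x.2.1 / b x.1 x.2.1 :=
    (he_meas.comp (measurable_fst.comp measurable_snd)).div
      (hb_meas.comp (measurable_fst.prodMk (measurable_fst.comp measurable_snd)))
  rw [← withDensity_ratio_eq he_meas hη hb_meas hπ hb,
    integral_withDensity_eq_integral_smul hW]
  refine integral_congr_ae (ae_of_all _ fun x => ?_)
  simp [NNReal.smul_def]

/-- The second moment of a weighted observation is at most `κ λ̄`. -/
theorem integral_ratio_featureProd_sq_le (hφm : ∀ i, Measurable (φ i : S → ℝ))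
    (hψm : ∀ j, Measurable (ψ j : A → ℝ)) (hφ : IsFeatureFamily φ) (hψ : IsFeatureFamily ψ)
    (hKS : ∀ s : S, realKernel HS s s ≤ K) (hKA : ∀ a : A, realKernel HA a a ≤ K)
    (he_meas : Measurable e) (he_pos : ∀ a, 0 < e a)
    (hη : η = ρ.withDensity fun a => (e a : ℝ≥0∞)) (hb_meas : Measurable (Function.uncurry b))
    (hπ : ∀ s, π s = ρ.withDensity fun a => (b s a : ℝ≥0∞)) (hκ : ratioSup e b ≠ ⊤)
    {u : EuclideanSpace ℝ (Fin dS)} {v : EuclideanSpace ℝ (Fin dA)}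
    {w : EuclideanSpace ℝ (Fin dS)} (hu : ‖u‖ = 1) (hv : ‖v‖ = 1) (hw : ‖w‖ = 1) :
    ∫ x, (((e x.2.1 : ℝ) / b x.1 x.2.1) * featureProd φ ψ u v w x) ^ 2
      ∂(ξ.compProd (π.compProd p)) ≤ (ratioSup e b).toReal * lambdaBar p ξ η φ ψ := by
  have hbk := ratio_ne_zero_and_le he_pos hκ
  have hg := measurable_featureProd hφm hψm u v w
  have hgB := abs_featureProd_le hφ hψ hKS hKA hu hv hw
  have hg2 : ∀ x, featureProd φ ψ u v w x ^ 2 ≤ (√K ^ 3) ^ 2 := fun x => by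
    rw [← sq_abs]
    exact pow_le_pow_left₀ (abs_nonneg _) (hgB x) 2
  have hW : Measurable fun x : S × A × S => (e x.2.1 : ℝ) / b x.1 x.2.1 :=
    (he_meas.comp (measurable_fst.comp measurable_snd)).coe_nnreal_real.div
      (hb_meas.comp (measurable_fst.prodMk (measurable_fst.comp
        measurable_snd))).coe_nnreal_real
  have hW0 : ∀ x : S × A × S, 0 ≤ (e x.2.1 : ℝ) / b x.1 x.2.1 := fun x => by positivity
  have hprob : IsProbabilityMeasure ((decoupledLaw p ξ η).map MeasurableEquiv.prodAssoc) :=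
    Measure.isProbabilityMeasure_map MeasurableEquiv.prodAssoc.measurable.aemeasurable
  -- The square contains two weights: one is spent on the change of measure, the other is bounded by
  -- `κ`, so the result is linear in `κ`.
  calc _ = ∫ x, ((e x.2.1 : ℝ) / b x.1 x.2.1) *
          (((e x.2.1 : ℝ) / b x.1 x.2.1) * featureProd φ ψ u v w x ^ 2)
          ∂(ξ.compProd (π.compProd p)) :=
        integral_congr_ae (ae_of_all _ fun x => by ring)
    _ = ∫ x, ((e x.2.1 : ℝ) / b x.1 x.2.1) * featureProd φ ψ u v w x ^ 2
          ∂((decoupledLaw p ξ η).map MeasurableEquiv.prodAssoc) :=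
        integral_ratio_mul_eq he_meas hη hb_meas hπ (fun s a => (hbk s a).1) _
    _ ≤ ∫ x, (ratioSup e b).toReal * featureProd φ ψ u v w x ^ 2
          ∂((decoupledLaw p ξ η).map MeasurableEquiv.prodAssoc) := by
        refine integral_mono (integrable_of_abs_sub_le (hW.mul (hg.pow_const 2)) (m := 0)
          (R := (ratioSup e b).toReal * (√K ^ 3) ^ 2) fun x => ?_)
          ((integrable_of_abs_sub_le (hg.pow_const 2) (m := 0) (R := (√K ^ 3) ^ 2)
            fun x => ?_).const_mul _) fun x => ?_
        · rw [sub_zero, abs_of_nonneg (mul_nonneg (hW0 x) (sq_nonneg _))]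
          exact mul_le_mul (hbk _ _).2 (hg2 x) (sq_nonneg _) ENNReal.toReal_nonneg
        · rw [sub_zero, abs_of_nonneg (sq_nonneg _)]
          exact hg2 x
        · exact mul_le_mul_of_nonneg_right (hbk _ _).2 (sq_nonneg _)
    _ ≤ _ := by
        rw [integral_const_mul]
        exact mul_le_mul_of_nonneg_left
          (integral_featureProd_sq_le_lambdaBar hφm hψm hφ hψ hKS hKA hu hv hw)
          ENNReal.toReal_nonneg

end Model

/-! ### Union bound and conclusion -/

theorem card_mul_exp_le {dS dA T : ℕ} {δ L : ℝ} (hT : 1 ≤ T) (hδ0 : 0 < δ) (hδ1 : δ < 1)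
    (hL : L = Real.log ((T : ℝ) / δ) + 8 * ((dS : ℝ) + dA)) :
    (5 : ℝ) ^ (dS + dA + dS) * Real.exp (-(8 * L)) ≤ δ := by
  have hT1 : (1 : ℝ) ≤ T := by exact_mod_cast hT
  have h1 : (5 : ℝ) ≤ Real.exp 2 := by
    have := Real.exp_one_gt_d9
    rw [show (2 : ℝ) = 1 + 1 by norm_num, Real.exp_add]
    nlinarith
  have hlog : 0 ≤ Real.log ((T : ℝ) / δ) :=
    Real.log_nonneg (by rw [le_div_iff₀ hδ0]; linarith)
  have hS : (0 : ℝ) ≤ dS := Nat.cast_nonneg _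
  have hA : (0 : ℝ) ≤ dA := Nat.cast_nonneg _
  -- As `5 ≤ exp 2`, the nets add at most `4 dS + 2 dA` to the exponent, well below the dimension
  -- term in `8 L`; a factor `exp (-log (T / δ))` remains.
  calc (5 : ℝ) ^ (dS + dA + dS) * Real.exp (-(8 * L))
      ≤ Real.exp 2 ^ (dS + dA + dS) * Real.exp (-(8 * L)) := by gcongr
    _ = Real.exp ((dS + dA + dS : ℕ) * 2 + -(8 * L)) := by
        rw [Real.exp_add, Real.exp_nat_mul]
    _ ≤ Real.exp (-Real.log ((T : ℝ) / δ)) := by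
        refine Real.exp_le_exp.2 ?_
        rw [hL]
        push_cast
        linarith
    _ = δ / T := by rw [Real.exp_neg, Real.exp_log (by positivity), inv_div]
    _ ≤ δ := div_le_self hδ0.le hT1

end TensorMDP

theorem mainTheorem2
    {S A Ω HS HA : Type*} [MeasurableSpace S] [MeasurableSpace A] [MeasurableSpace Ω]
    -- the reproducing kernel Hilbert spaces of functions on states and on actions
    [NormedAddCommGroup HS] [InnerProductSpace ℝ HS] [CompleteSpace HS] [RKHS ℝ HS S ℝ]
    [NormedAddCommGroup HA] [InnerProductSpace ℝ HA] [CompleteSpace HA] [RKHS ℝ HA A ℝ]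
    -- the transition kernel
    (p : Kernel (S × A) S) [IsMarkovKernel p]
    -- state and action features, with bounded kernels (`K_max < ∞`)
    {dS dA : ℕ} (φ : Fin dS → HS) (ψ : Fin dA → HA)
    (hφ_meas : ∀ i, Measurable (φ i : S → ℝ)) (hψ_meas : ∀ j, Measurable (ψ j : A → ℝ))
    (hφ : IsFeatureFamily φ) (hψ : IsFeatureFamily ψ)
    (hKS : BddAbove (Set.range fun s : S => realKernel HS s s))
    (hKA : BddAbove (Set.range fun a : A => realKernel HA a a))
    -- low Tucker rank of the transition operator
    (r l m : ℕ) (hrank : OperatorTuckerRankLE HS HA p r l m)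
    -- the positive probability measure `η` and the behavior policy, given by densities
    (ρ : Measure A) [SigmaFinite ρ]
    (η : Measure A) [IsProbabilityMeasure η] (e : A → ℝ≥0) (he_meas : Measurable e)
    (he_pos : ∀ a, 0 < e a) (hη : η = ρ.withDensity fun a => (e a : ℝ≥0∞))
    (π : Kernel S A) [IsMarkovKernel π] (b : S → A → ℝ≥0)
    (hb_meas : Measurable (Function.uncurry b))
    (hπ : ∀ s, π s = ρ.withDensity fun a => (b s a : ℝ≥0∞))
    (hκ : ratioSup e b ≠ ⊤)
    -- the stationary state distribution under the behavior policy
    (ξ : Measure S) [IsProbabilityMeasure ξ] (hξ : Kernel.Invariant (policyKernel p π) ξ)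
    (hlam : 0 < lambdaBar p ξ η φ ψ)
    -- the worst-case mixing time is finite
    (tmix : ℕ) (htmix : worstMixingTime p = (tmix : ℕ∞))
    -- the data: one sample path generated by the behavior policy
    (P : Measure Ω) [IsProbabilityMeasure P] (n : ℕ) (s : ℕ → Ω → S) (a : ℕ → Ω → A)
    (hpath : IsSamplePath P p π n s a)
    -- confidence level and sample-size condition
    (δ : ℝ) (hδ0 : 0 < δ) (hδ1 : δ < 1) (hn : 2 * tmix ≤ n)
    (hsample :
      ((n : ℝ) / tmix) / (Real.log ((n : ℝ) / tmix)) ^ 2 ≥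
        1024 * ((ratioSup e b).toReal * kernelMax (S := S) (A := A) HS HA ^ 3 /
          lambdaBar p ξ η φ ψ) * (Real.log ((tmix : ℝ) / δ) + 8 * ((dS : ℝ) + dA)))
    -- the low-rank estimate: a minimizer for every outcome
    (Fhat : Ω → Tensor3 dS dA dS)
    (hFhat : ∀ ω, IsBestLowRankApprox (r, l, m)
      (importanceEstimate e b φ ψ n (fun i => s i ω) (fun i => a i ω)) (Fhat ω)) :
    -- the bad event has (outer) probability at most `δ`
    P {ω | ¬ Tensor3.spectralNorm (Fhat ω - meanEmbedding p ξ η φ ψ) ≤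
        64 * Real.sqrt ((ratioSup e b).toReal * lambdaBar p ξ η φ ψ *
          (Real.log ((tmix : ℝ) / δ) + 8 * ((dS : ℝ) + dA)) *
          (Real.log ((n : ℝ) / tmix)) ^ 2 / ((n : ℝ) / tmix))} ≤ ENNReal.ofReal δ := by
  -- In dimension `0` the unit sphere is empty and the supremum `λ̄` takes the default value `0`,
  -- against `λ̄ > 0`.
  have hdS : dS ≠ 0 := by
    rintro rfl
    have : IsEmpty (USphere 0) := ⟨fun x => by simpa [Subsingleton.elim x.1 0] using x.2⟩
    exact hlam.ne' (Real.iSup_of_isEmpty _)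
  have hdA : dA ≠ 0 := by
    rintro rfl
    have : IsEmpty (USphere 0) := ⟨fun x => by simpa [Subsingleton.elim x.1 0] using x.2⟩
    exact hlam.ne' (Real.iSup_of_isEmpty _)
  have : NeZero dS := ⟨hdS⟩
  have : NeZero dA := ⟨hdA⟩
  obtain ⟨hT1, hmix⟩ := one_le_and_isMixedFrom_of_worstMixingTime_eq htmix π
  obtain ⟨s₀⟩ : Nonempty S := nonempty_of_isProbabilityMeasure ξ
  obtain ⟨a₀⟩ : Nonempty A := nonempty_of_isProbabilityMeasure η
  set κ := (ratioSup e b).toReal with hκdef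
  set K := kernelMax (S := S) (A := A) HS HA with hKdef
  set lam := lambdaBar p ξ η φ ψ with hlamdef
  set L := Real.log ((tmix : ℝ) / δ) + 8 * ((dS : ℝ) + dA) with hLdef
  set x : ℝ := (n : ℝ) / tmix with hxdef
  have hKS' : ∀ s : S, realKernel HS s s ≤ K := fun s => le_max_of_le_left (le_ciSup hKS s)
  have hKA' : ∀ a : A, realKernel HA a a ≤ K := fun a => le_max_of_le_right (le_ciSup hKA a)
  have hK0 : 0 ≤ K := (hφ.norm_featureVec_sq s₀ ▸ sq_nonneg _ : 0 ≤ realKernel HS s₀ s₀).trans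
    (hKS' s₀)
  have hbk := ratio_ne_zero_and_le he_pos hκ
  have hκ0 : 0 < κ := by
    refine lt_of_lt_of_le (div_pos ?_ ?_) (hbk s₀ a₀).2
    · exact_mod_cast he_pos a₀
    · exact_mod_cast pos_iff_ne_zero.2 (hbk s₀ a₀).1
  have hT0 : (0 : ℝ) < tmix := by exact_mod_cast hT1
  have hx2 : 2 ≤ x := by
    rw [hxdef, le_div_iff₀ hT0]
    exact_mod_cast hn
  have hx0 : 0 < x := by linarith
  have hy0 : 0 < Real.log x := Real.log_pos (by linarith)
  have hL2 : 2 ≤ L := by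
    have h1 : 0 ≤ Real.log ((tmix : ℝ) / δ) := by
      refine Real.log_nonneg ?_
      rw [le_div_iff₀ hδ0]
      have : (1 : ℝ) ≤ tmix := by exact_mod_cast hT1
      linarith
    have h2 : (1 : ℝ) ≤ dS := by exact_mod_cast Nat.one_le_iff_ne_zero.2 hdS
    have h3 : (0 : ℝ) ≤ dA := Nat.cast_nonneg _
    rw [hLdef]
    linarith
  have hsample' : 1024 * (κ * K ^ 3 * L * Real.log x ^ 2) ≤ lam * x := by
    have h1 := hsample
    rw [ge_iff_le, le_div_iff₀ (by positivity)] at h1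
    calc 1024 * (κ * K ^ 3 * L * Real.log x ^ 2)
        = lam * (1024 * (κ * K ^ 3 / lam) * L * Real.log x ^ 2) := by field_simp
      _ ≤ lam * x := by gcongr
  -- A quarter of the claimed radius: one factor `2` goes to the comparison with the minimizer, the
  -- other to the nets.
  set t := 16 * √(κ * lam * L * Real.log x ^ 2 / x) with htdef
  have ht0 : 0 ≤ t := by positivity
  -- This is the sample-size condition: after squaring, `256 · 4 = 1024` is its constant. It puts `θ
  -- B ≤ 1/4`, the range where the Bernstein bound holds.
  have htB : t * (κ * √K ^ 3) ≤ κ * lam / 2 := by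
    refine abs_le_of_sq_le_sq' ?_ (by positivity) |>.2
    have h1 : (√K ^ 3) ^ 2 = K ^ 3 := by rw [pow_right_comm, Real.sq_sqrt hK0]
    calc (t * (κ * √K ^ 3)) ^ 2
        = κ ^ 2 * lam / (4 * x) * (1024 * (κ * K ^ 3 * L * Real.log x ^ 2)) := by
          rw [htdef, mul_pow, mul_pow, mul_pow, Real.sq_sqrt (by positivity), h1]
          field_simp
          ring
      _ ≤ κ ^ 2 * lam / (4 * x) * (lam * x) := by gcongr
      _ = (κ * lam / 2) ^ 2 := by field_simp; ring
  obtain ⟨NS, hNScard, hNS1, hNS⟩ := exists_sphere_net dS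
  obtain ⟨NA, hNAcard, hNA1, hNA⟩ := exists_sphere_net dA
  set f : EuclideanSpace ℝ (Fin dS) × EuclideanSpace ℝ (Fin dA) × EuclideanSpace ℝ (Fin dS) →
    S × A × S → ℝ := fun y x => ((e x.2.1 : ℝ) / b x.1 x.2.1) *
      featureProd φ ψ y.1 y.2.1 y.2.2 x with hf
  have hfm : ∀ y, Measurable (f y) := fun y =>
    ((he_meas.comp (measurable_fst.comp measurable_snd)).coe_nnreal_real.div
      (hb_meas.comp (measurable_fst.prodMk (measurable_fst.comp
        measurable_snd))).coe_nnreal_real).mul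
      (measurable_featureProd hφ_meas hψ_meas y.1 y.2.1 y.2.2)
  set J := ξ.compProd (π.compProd p) with hJ
  have hmean : ∀ y, ∫ x, f y x ∂J = (meanEmbedding p ξ η φ ψ).apply y.1 y.2.1 y.2.2 := fun y => by
    rw [apply_meanEmbedding hφ_meas hψ_meas hφ hψ hKS' hKA']
    exact integral_ratio_mul_eq he_meas hη hb_meas hπ (fun s a => (hbk s a).1) _
  have hbern : ∀ y ∈ NS ×ˢ NA ×ˢ NS, P {ω | n * t ≤ ∑ i ∈ Finset.range n,
      (f y (s i ω, a i ω, s (i + 1) ω) - ∫ w, f y w ∂J)} ≤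
      ENNReal.ofReal (Real.exp (-(8 * L))) := by
    rintro ⟨u, v, w⟩ hy
    obtain ⟨hu, hy⟩ := Finset.mem_product.1 hy
    obtain ⟨hv, hw⟩ := Finset.mem_product.1 hy
    refine hpath.bernstein hmix hT1 hn hξ (hfm _) (B := κ * √K ^ 3) (V := κ * lam)
      (by positivity) (fun x => ?_) ?_ (by positivity) hL2 htdef htB
    · rw [hf, abs_mul, abs_of_nonneg (by positivity)]
      exact mul_le_mul (hbk _ _).2 (abs_featureProd_le hφ hψ hKS' hKA' (hNS1 u hu) (hNA1 v hv)
        (hNS1 w hw) x) (abs_nonneg _) hκ0.le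
    · exact integral_ratio_featureProd_sq_le hφ_meas hψ_meas hφ hψ hKS' hKA' he_meas he_pos hη
        hb_meas hπ hκ (hNS1 u hu) (hNA1 v hv) (hNS1 w hw)
  -- Only monotonicity of the outer measure is applied to this inclusion, so the minimizer need not
  -- depend measurably on `ω`.
  have hsub : {ω | ¬ Tensor3.spectralNorm (Fhat ω - meanEmbedding p ξ η φ ψ) ≤
      64 * √(κ * lam * L * Real.log x ^ 2 / x)} ⊆ ⋃ y ∈ NS ×ˢ NA ×ˢ NS,
      {ω | n * t ≤ ∑ i ∈ Finset.range n,
        (f y (s i ω, a i ω, s (i + 1) ω) - ∫ w, f y w ∂J)} := by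
    intro ω hω
    rw [Set.mem_ofPred_eq, not_le] at hω
    have h1 := (hFhat ω).spectralNorm_sub_le
      (tuckerRank_meanEmbedding_le (ξ := ξ) (η := η) hφ_meas hψ_meas hφ hψ hKS' hKA' hrank)
    obtain ⟨u, hu, v, hv, w, hw, h2⟩ := Tensor3.exists_net_of_lt_spectralNorm _ hNS hNA hNS ht0
      (show 2 * t < _ by rw [htdef]; linarith)
    refine Set.mem_biUnion (x := (u, v, w)) (Finset.mem_product.2
      ⟨hu, Finset.mem_product.2 ⟨hv, hw⟩⟩) ?_
    rw [sub_eq_add_neg, Tensor3.apply_add, Tensor3.apply_neg, apply_importanceEstimate,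
      ← hmean (u, v, w)] at h2
    have hn0 : (0 : ℝ) < n := by
      rw [hxdef] at hx0
      exact (div_pos_iff_of_pos_right hT0).1 hx0
    rw [Set.mem_ofPred_eq, Finset.sum_sub_distrib, Finset.sum_const, Finset.card_range,
      nsmul_eq_mul]
    have h3 := mul_le_mul_of_nonneg_left h2 hn0.le
    rwa [mul_add, mul_inv_cancel_left₀ hn0.ne', mul_neg, ← sub_eq_add_neg] at h3
  calc _ ≤ _ := measure_mono hsub
    _ ≤ ∑ y ∈ NS ×ˢ NA ×ˢ NS, P {ω | n * t ≤ ∑ i ∈ Finset.range n,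
        (f y (s i ω, a i ω, s (i + 1) ω) - ∫ w, f y w ∂J)} := measure_biUnion_finset_le _ _
    _ ≤ ∑ y ∈ NS ×ˢ NA ×ˢ NS, ENNReal.ofReal (Real.exp (-(8 * L))) := Finset.sum_le_sum hbern
    _ = ENNReal.ofReal ((NS ×ˢ NA ×ˢ NS).card * Real.exp (-(8 * L))) := by
        rw [Finset.sum_const, nsmul_eq_mul, ENNReal.ofReal_mul (Nat.cast_nonneg _),
          ENNReal.ofReal_natCast]
    _ ≤ ENNReal.ofReal ((5 : ℝ) ^ (dS + dA + dS) * Real.exp (-(8 * L))) := by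
        gcongr
        have : (NS ×ˢ NA ×ˢ NS).card ≤ 5 ^ (dS + dA + dS) := by
          rw [Finset.card_product, Finset.card_product, pow_add, pow_add, mul_assoc]
          gcongr
        exact_mod_cast this
    _ ≤ ENNReal.ofReal δ := ENNReal.ofReal_le_ofReal (card_mul_exp_le hT1 hδ0 hδ1 hLdef)
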